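/- All graphs are finite and simple, and $\mu(G)$ denotes the number of edges of a maximum matching of $G$. For integers $\beta > \beta^- \ge 1$, a subgraph $H$ of a graph $G$ (on the same vertex set) is a $(\beta,\beta^-)$-EDCS of $G$ if $\deg_H(u)+\deg_H(v) \le \beta$ for every edge $(u,v)$ of $H$, and $\deg_H(u)+\deg_H(v) \ge \beta^-$ for every edge $(u,v)$ of $G$ that is not in $H$. Let $A$, $L\setminus A$, $N(A)$, $R\setminus N(A)$, $M$, $M^*$, $H$ be formal labels. A *valid vertex profile* $\mathsf v$ consists of a position in $\{A,\ L\setminus A,\ N(A),\ R\setminus N(A)\}$, a degree $\mathsf v_{\deg} \in \{0,\dots,\beta-1\}$, a flag "matched in $M$" and a flag "matched in $M^*$", such that (1) if the position is $N(A)$ or $L\setminus A$, then $\mathsf v$ is matched in $M$; (2) if $\mathsf v_{\deg}=0$, then $\mathsf v$ is not matched in $M$. Let $VP$ be the set of valid vertex profiles. A *valid edge profile* $\mathsf e$ consists of two valid vertex profiles (its endpoints), the left one with position $A$ or $L\setminus A$ and the right one with position $N(A)$ or $R\setminus N(A)$, and three flags "in $H$", "in $M$", "in $M^*$", such that (3)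 if $\mathsf e$ is in $H$, both endpoints have nonzero degree; (4) if $\mathsf e$ is in $M$ (resp. in $M^*$), both endpoints are matched in $M$ (resp. in $M^*$); (5) if $\mathsf e$ is in $M$, it is in $H$; (6) $\mathsf e$ is in $H$ or in $M^*$; (7) if $\mathsf e$ is in $H$, the degrees of its endpoints sum to at most $\beta$; (8) if $\mathsf e$ is not in $H$, the degrees of its endpoints sum to at least $\beta^-$; (9) if $\mathsf e$ is in $H$, its endpoints do not have positions $A$ and $R\setminus N(A)$; (10) if $\mathsf e$ is in $M$, exactly one of the following holds: its right endpoint has position $N(A)$, or its left endpoint has position $L\setminus A$. Let $EP$ be the set of valid edge profiles. For $\mathsf v\in VP$ let $H(\mathsf v)$, $M(\mathsf v)$, $M^*(\mathsf v)$ be the sets of $\mathsf e \in EP$ that are in $H$, $M$, $M^*$ respectively and have $\mathsf v$ as one of their endpoints. Consider the linear program in real variables $x_{\mathsf v}\ge 0$ ($\mathsf v\in VP$) and $x_{\mathsf e}\ge 0$ ($\mathsf e\in EP$): $$\text{maximize}\ \sum_{\mathsf e\in EP,\ \mathsf e\in M^*} x_{\mathsf e}$$ subject to $$\sum_{\mathsf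 e\in H(\mathsf v)} x_{\mathsf e} = \mathsf v_{\deg}\, x_{\mathsf v}\quad (\mathsf v\in VP),\qquad \sum_{\mathsf e\in M(\mathsf v)} x_{\mathsf e} = x_{\mathsf v}\quad (\mathsf v\in VP \text{ matched in } M),$$ $$\sum_{\mathsf e\in M^*(\mathsf v)} x_{\mathsf e} = x_{\mathsf v}\quad (\mathsf v\in VP \text{ matched in } M^*),\qquad \sum_{\mathsf e\in EP,\ \mathsf e \in M} x_{\mathsf e} = 1 .$$ **Theorem.** Let $\beta > \beta^- \ge 1$ be integers. The linear program has an optimal solution, and its optimal value $r$ is the worst-case approximation ratio of a $(\beta,\beta^-)$-EDCS on bipartite graphs: for every bipartite graph $G$ and every $(\beta,\beta^-)$-EDCS $H$ of $G$ we have $\mu(G)\le r\cdot\mu(H)$, and there are a bipartite graph $G$ and a $(\beta,\beta^-)$-EDCS $H$ of $G$ with $\mu(H)>0$ and $\mu(G)=r\cdot\mu(H)$. -/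

import Mathlib

namespace EDCS

/-! ### Graphs -/

/-- The size `μ(G)` of a maximum matching: the largest number of edges of a matching of `G`. -/
noncomputable def matchingNumber {V : Type*} [Fintype V] (G : SimpleGraph V) : ℕ :=
  sSup {n : ℕ | ∃ M : G.Subgraph, M.IsMatching ∧ M.edgeSet.ncard = n}

/-- `H` is an edge-degree constrained subgraph of `G` with parameters `(β, β⁻)`. -/
structure IsEDCS {V : Type*} [Fintype V] (β βm : ℕ) (G H : SimpleGraph V)
    [DecidableRel H.Adj] : Prop where
  le : H ≤ G
  deg_add_le : ∀ u v, H.Adj u v → H.degree u + H.degree v ≤ β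
  le_deg_add : ∀ u v, G.Adj u v → ¬ H.Adj u v → βm ≤ H.degree u + H.degree v

/-! ### Vertex profiles and edge profiles

`A` is a Hall witness for `H`, `M` a maximum matching of `H` and `M*` one of `G`. -/

/-- The position of a vertex: in `A`, `L \ A`, `N_H(A)` or `R \ N_H(A)`. -/
inductive Pos
  | A
  | LdiffA
  | NA
  | RdiffNA
  deriving DecidableEq

instance : Fintype Pos where
  elems := {Pos.A, Pos.LdiffA, Pos.NA, Pos.RdiffNA}
  complete := by intro p; cases p <;> decide

/-- A position on the side `L`. -/
def Pos.InL (p : Pos) : Prop := p = Pos.A ∨ p = Pos.LdiffA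

/-- A position on the side `R`. -/
def Pos.InR (p : Pos) : Prop := p = Pos.NA ∨ p = Pos.RdiffNA

instance (p : Pos) : Decidable p.InL := inferInstanceAs (Decidable (_ ∨ _))

instance (p : Pos) : Decidable p.InR := inferInstanceAs (Decidable (_ ∨ _))

/-- The properties of a vertex that its profile records. -/
structure VertexProfile (β : ℕ) where
  pos : Pos
  /-- the degree in `H`, between `0` and `β - 1` -/
  deg : Fin β
  /-- matched in `M` -/
  inM : Bool
  /-- matched in `M*` -/
  inMstar : Bool
  deriving DecidableEq, Fintype

/-- Validity of a vertex profile: a vertex of `N_H(A)` or of `L \ A` is matched in `M`, and a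
vertex of degree zero is not matched in `M`. -/
def VertexProfile.Valid {β : ℕ} (v : VertexProfile β) : Prop :=
  ((v.pos = Pos.NA ∨ v.pos = Pos.LdiffA) → v.inM = true) ∧
  ((v.deg : ℕ) = 0 → v.inM = false)

instance {β : ℕ} (v : VertexProfile β) : Decidable v.Valid := inferInstanceAs (Decidable (_ ∧ _))

/-- The set `VP` of valid vertex profiles. -/
abbrev VP (β : ℕ) : Type := {v : VertexProfile β // v.Valid}

/-- The properties of an edge that its profile records. -/
structure EdgeProfile (β : ℕ) where
  /-- the vertex profile of the endpoint in `L` -/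
  left : VP β
  /-- the vertex profile of the endpoint in `R` -/
  right : VP β
  inH : Bool
  inM : Bool
  inMstar : Bool
  deriving DecidableEq, Fintype

/-- Validity of an edge profile. -/
def EdgeProfile.Valid {β : ℕ} (βm : ℕ) (e : EdgeProfile β) : Prop :=
  -- the endpoints lie in `L` and in `R`
  (e.left.1.pos.InL ∧ e.right.1.pos.InR) ∧
  -- the endpoints of an edge of `H` have nonzero degree in `H`
  (e.inH = true → (e.left.1.deg : ℕ) ≠ 0 ∧ (e.right.1.deg : ℕ) ≠ 0) ∧
  -- the endpoints of an edge of `M` (of `M*`) are matched in `M` (in `M*`)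
  (e.inM = true → e.left.1.inM = true ∧ e.right.1.inM = true) ∧
  (e.inMstar = true → e.left.1.inMstar = true ∧ e.right.1.inMstar = true) ∧
  -- an edge of `M` is in `H`
  (e.inM = true → e.inH = true) ∧
  -- there are no edges outside `H ∪ M*`
  (e.inH = true ∨ e.inMstar = true) ∧
  -- the two degree conditions of an EDCS
  (e.inH = true → (e.left.1.deg : ℕ) + (e.right.1.deg : ℕ) ≤ β) ∧
  (e.inH = false → βm ≤ (e.left.1.deg : ℕ) + (e.right.1.deg : ℕ)) ∧
  -- there are no edges of `H` between `A` and `R \ N_H(A)`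
  (e.inH = true → ¬ (e.left.1.pos = Pos.A ∧ e.right.1.pos = Pos.RdiffNA)) ∧
  -- an edge of `M` either has an endpoint in `N_H(A)` or one in `L \ A`, not both
  (e.inM = true → Xor (e.right.1.pos = Pos.NA) (e.left.1.pos = Pos.LdiffA))

instance {β : ℕ} (βm : ℕ) (e : EdgeProfile β) : Decidable (e.Valid βm) := by
  unfold EdgeProfile.Valid; infer_instance

/-- The set `EP` of valid edge profiles. -/
abbrev EP (β βm : ℕ) : Type := {e : EdgeProfile β // e.Valid βm}

/-- One of the endpoints of the edge profile `e` has the vertex profile `v`. -/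
def EdgeProfile.Touches {β : ℕ} (e : EdgeProfile β) (v : VP β) : Prop :=
  e.left = v ∨ e.right = v

instance {β : ℕ} (e : EdgeProfile β) (v : VP β) : Decidable (e.Touches v) :=
  inferInstanceAs (Decidable (_ ∨ _))

/-! ### The factor-revealing linear program -/

/-- Feasibility of an assignment of real values to the variables: `x v` for the vertex profiles
`v ∈ VP` and `y e` for the edge profiles `e ∈ EP`. -/
structure LPFeasible (β βm : ℕ) (x : VP β → ℝ) (y : EP β βm → ℝ) : Prop where
  sum_H : ∀ v : VP β,
    ∑ e : EP β βm with e.1.inH = true ∧ e.1.Touches v, y e = ((v.1.deg : ℕ) : ℝ) * x v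
  sum_M : ∀ v : VP β, v.1.inM = true →
    ∑ e : EP β βm with e.1.inM = true ∧ e.1.Touches v, y e = x v
  sum_Mstar : ∀ v : VP β, v.1.inMstar = true →
    ∑ e : EP β βm with e.1.inMstar = true ∧ e.1.Touches v, y e = x v
  sum_M_eq_one : ∑ e : EP β βm with e.1.inM = true, y e = 1
  edge_nonneg : ∀ e, 0 ≤ y e
  vertex_nonneg : ∀ v, 0 ≤ x v

/-- The objective of the linear program: the total value of the edge profiles in `M*`. -/
noncomputable def lpObjective (β βm : ℕ) (y : EP β βm → ℝ) : ℝ :=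
  ∑ e : EP β βm with e.1.inMstar = true, y e

/-- `r` is the optimal value of the linear program: the maximum of the objective over all feasible
solutions (attained, and an upper bound). -/
def IsLPOptimalValue (β βm : ℕ) (r : ℝ) : Prop :=
  IsGreatest {t : ℝ | ∃ (x : VP β → ℝ) (y : EP β βm → ℝ),
    LPFeasible β βm x y ∧ lpObjective β βm y = t} r

end EDCS

/-!
Given an EDCS `H` of a bipartite graph `G`, take maximum matchings `M` of `H` and `M*` of `G` and,
by König's theorem, a vertex cover of `H` with one endpoint of each edge of `M`. Counting the
vertices and the edges of `H ∪ M*` by profile gives a solution of the linear program scaled by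
`μ(H)`, with objective `μ(G)`.

Conversely, an optimal solution can be chosen rational, hence, after scaling, integral. Its values
are the vertex and edge counts of a bipartite multigraph in which the endpoints of the edges can be
distributed evenly over the vertices of each profile. A simple covering graph of it is an EDCS whose
cover read off from the profiles bounds `μ(H)`, while the lifted `M*` is a matching.
-/

namespace EDCS

open Finset

section Matching

variable {V : Type*} {G M : SimpleGraph V}

/-- A matching, encoded as a spanning graph in which every vertex has at most one neighbour; the
matchings of `G` are then the graphs `M ≤ G` with `IsMatching M`. -/
def IsMatching (M : SimpleGraph V) : Prop :=
  ∀ ⦃u v w⦄, M.Adj u v → M.Adj u w → v = w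

theorem IsMatching.degree_le_one (hM : IsMatching M) (v : V) [Fintype (M.neighborSet v)] :
    M.degree v ≤ 1 :=
  card_le_one.2 fun _ ha _ hb =>
    hM ((M.mem_neighborFinset ..).1 ha) ((M.mem_neighborFinset ..).1 hb)

theorem one_le_card_filter_mem_of_isVertexCover [DecidableEq V] {C : Finset V}
    (hC : G.IsVertexCover (C : Set V)) {e : Sym2 V} (he : e ∈ G.edgeSet) :
    1 ≤ #{c ∈ C | c ∈ e} := by
  obtain ⟨c, hc, hce⟩ : ∃ c ∈ C, c ∈ e := by
    induction e with
    | h u v =>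
      exact (hC he).elim (⟨u, ·, Sym2.mem_mk_left u v⟩) (⟨v, ·, Sym2.mem_mk_right u v⟩)
  exact card_pos.2 ⟨c, mem_filter.2 ⟨hc, hce⟩⟩

theorem isVertexCover_exchange {C S : Set V} (hC : G.IsVertexCover C) (hS : G.IsIndepSet S) :
    G.IsVertexCover (C \ S ∪ (⋃ u ∈ S, G.neighborSet u) \ C) := by
  intro u v huv
  have hindep : ¬(u ∈ S ∧ v ∈ S) := fun h => hS h.1 h.2 huv.ne huv
  have hu : u ∈ S → v ∈ ⋃ u ∈ S, G.neighborSet u := fun h => Set.mem_biUnion h huv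
  have hv : v ∈ S → u ∈ ⋃ u ∈ S, G.neighborSet u := fun h => Set.mem_biUnion h huv.symm
  have := hC huv
  simp only [Set.mem_union, Set.mem_sdiff]
  tauto

theorem exists_isBipartiteWith_compl (hG : G.IsBipartite) :
    ∃ L : Set V, G.IsBipartiteWith L Lᶜ := by
  obtain ⟨s, t, h⟩ := hG.exists_isBipartiteWith
  have hts : t ⊆ sᶜ := Set.subset_compl_iff_disjoint_left.2 h.disjoint
  exact ⟨s, disjoint_compl_right, fun u v huv =>
    (h.mem_of_adj huv).imp (And.imp_right (@hts v)) (And.imp_left (@hts u))⟩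

section Incidence

variable [Fintype V]

theorem sum_degree_eq_sum_card_filter_mem [DecidableEq V] (G : SimpleGraph V)
    [DecidableRel G.Adj] (C : Finset V) :
    ∑ c ∈ C, G.degree c = ∑ e ∈ G.edgeFinset, #{c ∈ C | c ∈ e} := by
  simp only [← G.card_incidenceFinset_eq_degree, G.incidenceFinset_eq_filter]
  exact sum_card_bipartiteAbove_eq_sum_card_bipartiteBelow (fun c e => c ∈ e)

theorem IsMatching.sum_card_filter_mem_le [DecidableEq V] [DecidableRel M.Adj]
    (hM : IsMatching M) (C : Finset V) : ∑ e ∈ M.edgeFinset, #{c ∈ C | c ∈ e} ≤ #C := by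
  rw [← sum_degree_eq_sum_card_filter_mem]
  simpa using sum_le_card_nsmul C _ 1 fun c _ => hM.degree_le_one c

end Incidence

section Finite

variable [Finite V]

theorem bddAbove_matchingNumber_set (G : SimpleGraph V) :
    BddAbove {n : ℕ | ∃ M : G.Subgraph, M.IsMatching ∧ M.edgeSet.ncard = n} := by
  refine ⟨Nat.card (Sym2 V), ?_⟩
  rintro _ ⟨M, -, rfl⟩
  exact Set.ncard_le_card _

theorem IsMatching.ncard_edgeSet_le_card_of_isVertexCover (hM : IsMatching M) {C : Finset V}
    (hC : M.IsVertexCover (C : Set V)) : M.edgeSet.ncard ≤ #C := by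
  classical
  cases nonempty_fintype V
  rw [← M.coe_edgeFinset, Set.ncard_coe_finset]
  calc #M.edgeFinset ≤ ∑ e ∈ M.edgeFinset, #{c ∈ C | c ∈ e} := by
        simpa using card_nsmul_le_sum _ _ 1 fun e he =>
          one_le_card_filter_mem_of_isVertexCover hC (M.mem_edgeFinset.1 he)
    _ ≤ #C := hM.sum_card_filter_mem_le C

theorem IsMatching.exists_adj_of_card_eq (hM : IsMatching M) {C : Finset V}
    (hC : M.IsVertexCover (C : Set V)) (hcard : #C = M.edgeSet.ncard) {c : V} (hc : c ∈ C) :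
    ∃ v, M.Adj c v := by
  classical
  by_contra! hfree
  have hC' : M.IsVertexCover (C.erase c : Set V) := by
    intro u v huv
    have hu : u ≠ c := fun h => hfree v (h ▸ huv)
    have hv : v ≠ c := fun h => hfree u (h ▸ huv.symm)
    simpa [hu, hv] using hC huv
  have := hM.ncard_edgeSet_le_card_of_isVertexCover hC'
  rw [← hcard] at this
  exact (card_erase_lt_of_mem hc).not_ge this

theorem IsMatching.not_mem_and_mem_of_card_eq (hM : IsMatching M) {C : Finset V}
    (hC : M.IsVertexCover (C : Set V)) (hcard : #C = M.edgeSet.ncard) {u v : V} (huv : M.Adj u v) :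
    ¬(u ∈ C ∧ v ∈ C) := by
  classical
  cases nonempty_fintype V
  rintro ⟨hu, hv⟩
  rw [← M.coe_edgeFinset, Set.ncard_coe_finset] at hcard
  have htwo : 1 < #{c ∈ C | c ∈ s(u, v)} :=
    one_lt_card.2 ⟨u, by simp [hu], v, by simp [hv], huv.ne⟩
  have hlt : ∑ _e ∈ M.edgeFinset, 1 < ∑ e ∈ M.edgeFinset, #{c ∈ C | c ∈ e} :=
    sum_lt_sum (fun e he => one_le_card_filter_mem_of_isVertexCover hC (M.mem_edgeFinset.1 he))
      ⟨s(u, v), M.mem_edgeFinset.2 huv, htwo⟩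
  rw [← card_eq_sum_ones, ← hcard] at hlt
  exact hlt.not_ge (hM.sum_card_filter_mem_le C)

theorem card_le_ncard_edgeSet {C : Finset V} (hC : ∀ c ∈ C, ∃ v ∉ C, G.Adj c v) :
    #C ≤ G.edgeSet.ncard := by
  choose! f hf hadj using hC
  rw [← Set.ncard_coe_finset]
  refine Set.ncard_le_ncard_of_injOn (fun c => s(c, f c)) (fun c hc => hadj c hc) ?_
  intro c hc d hd hcd
  obtain ⟨rfl, -⟩ | ⟨rfl, -⟩ := Sym2.eq_iff.1 hcd
  · rfl
  · exact absurd hc (hf d hd)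

theorem ncard_le_ncard_neighbors_diff {C S : Set V} (hC : G.IsVertexCover C)
    (hmin : ∀ D, G.IsVertexCover D → C.ncard ≤ D.ncard) (hSC : S ⊆ C) (hS : G.IsIndepSet S) :
    S.ncard ≤ ((⋃ u ∈ S, G.neighborSet u) \ C).ncard := by
  have h1 := hmin _ (isVertexCover_exchange hC hS)
  have h2 := Set.ncard_union_le (C \ S) ((⋃ u ∈ S, G.neighborSet u) \ C)
  have h3 := Set.ncard_sdiff_add_ncard_of_subset hSC
  omega

theorem ncard_le_ncard_neighborSet_between {C S L : Set V} (hG : G.IsBipartiteWith L Lᶜ)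
    (hC : G.IsVertexCover C) (hmin : ∀ D, G.IsVertexCover D → C.ncard ≤ D.ncard) (hSC : S ⊆ C) :
    S.ncard ≤ (⋃ u ∈ S, (G.between C Cᶜ).neighborSet u).ncard := by
  have hL : G.IsIndepSet (S ∩ L) := by
    rintro u hu v hv - huv
    have := hG.mem_of_adj huv
    simp_all
  have hR : G.IsIndepSet (S \ L) := by
    rintro u hu v hv - huv
    have := hG.mem_of_adj huv
    simp_all
  have hdisj : Disjoint ((⋃ u ∈ S ∩ L, G.neighborSet u) \ C)
      ((⋃ u ∈ S \ L, G.neighborSet u) \ C) := by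
    rw [Set.disjoint_left]
    rintro v hv hv'
    simp only [Set.mem_sdiff, Set.mem_iUnion, SimpleGraph.mem_neighborSet,
      Set.mem_inter_iff] at hv hv'
    obtain ⟨⟨a, ⟨-, ha⟩, hav⟩, -⟩ := hv
    obtain ⟨⟨b, ⟨-, hb⟩, hbv⟩, -⟩ := hv'
    have h1 := hG.mem_of_adj hav
    have h2 := hG.mem_of_adj hbv
    simp_all
  calc S.ncard = (S ∩ L).ncard + (S \ L).ncard :=
        (Set.ncard_inter_add_ncard_sdiff_eq_ncard S L).symm
    _ ≤ ((⋃ u ∈ S ∩ L, G.neighborSet u) \ C).ncard +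
          ((⋃ u ∈ S \ L, G.neighborSet u) \ C).ncard :=
        Nat.add_le_add
          (ncard_le_ncard_neighbors_diff hC hmin (Set.inter_subset_left.trans hSC) hL)
          (ncard_le_ncard_neighbors_diff hC hmin (Set.sdiff_subset.trans hSC) hR)
    _ = _ := (Set.ncard_union_eq hdisj).symm
    _ ≤ (⋃ u ∈ S, (G.between C Cᶜ).neighborSet u).ncard := by
        refine Set.ncard_le_ncard fun v hv => ?_
        simp only [Set.mem_union, Set.mem_sdiff, Set.mem_iUnion, SimpleGraph.mem_neighborSet,
          Set.mem_inter_iff] at hv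
        simp only [Set.mem_iUnion, SimpleGraph.mem_neighborSet, SimpleGraph.between_adj]
        obtain ⟨⟨u, ⟨hu, -⟩, huv⟩, hv⟩ | ⟨⟨u, ⟨hu, -⟩, huv⟩, hv⟩ := hv <;>
          exact ⟨u, hu, huv, Or.inl ⟨hSC hu, hv⟩⟩

end Finite

section MatchingNumber

variable [Fintype V]

theorem IsMatching.ncard_edgeSet_le_matchingNumber (hM : IsMatching M) (hMG : M ≤ G) :
    M.edgeSet.ncard ≤ matchingNumber G := by
  let S : G.Subgraph :=
    { verts := M.support
      Adj := M.Adj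
      adj_sub := fun h => hMG h
      edge_vert := fun h => ⟨_, h⟩
      symm := M.symm }
  refine le_csSup (bddAbove_matchingNumber_set G) ⟨S, ?_, ?_⟩
  · rintro v ⟨w, hw⟩
    exact ⟨w, hw, fun u hu => hM hu hw⟩
  · rw [← S.edgeSet_spanningCoe]
    rfl

theorem exists_isMatching_ncard_edgeSet_eq (G : SimpleGraph V) :
    ∃ M ≤ G, IsMatching M ∧ M.edgeSet.ncard = matchingNumber G := by
  have hne : {n : ℕ | ∃ S : G.Subgraph, S.IsMatching ∧ S.edgeSet.ncard = n}.Nonempty :=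
    ⟨0, ⊥, by simp [SimpleGraph.Subgraph.IsMatching]⟩
  obtain ⟨S, hS, hcard⟩ := Nat.sSup_mem hne (bddAbove_matchingNumber_set G)
  refine ⟨S.spanningCoe, S.spanningCoe_le, fun u v w hv hw => ?_, ?_⟩
  · exact (hS (S.edge_vert hv)).unique hv hw
  · rw [S.edgeSet_spanningCoe]
    exact hcard

theorem matchingNumber_pos_of_adj {u v : V} (h : G.Adj u v) : 0 < matchingNumber G := by
  have hM : IsMatching (SimpleGraph.edge u v) := by
    intro a b c hb hc
    simp only [SimpleGraph.edge_adj] at hb hc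
    grind
  have hle : SimpleGraph.edge u v ≤ G := (SimpleGraph.edge_le_iff G).2 (Or.inr h)
  refine lt_of_lt_of_le ?_ (hM.ncard_edgeSet_le_matchingNumber hle)
  simp [SimpleGraph.edgeSet_edge_of_ne h.ne]

theorem matchingNumber_le_card_of_isVertexCover {C : Finset V}
    (hC : G.IsVertexCover (C : Set V)) : matchingNumber G ≤ #C := by
  obtain ⟨M, hMG, hM, hcard⟩ := exists_isMatching_ncard_edgeSet_eq G
  exact hcard ▸ hM.ncard_edgeSet_le_card_of_isVertexCover (hC.mono hMG)

/-- **König's theorem** -/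
theorem exists_isVertexCover_card_eq_matchingNumber (hG : G.IsBipartite) :
    ∃ C : Finset V, G.IsVertexCover (C : Set V) ∧ #C = matchingNumber G := by
  classical
  obtain ⟨L, hL⟩ := exists_isBipartiteWith_compl hG
  obtain ⟨C, hC, hmin⟩ := exists_min_image {C : Finset V | G.IsVertexCover (C : Set V)} card
    ⟨univ, by simp⟩
  simp only [mem_filter, mem_univ, true_and] at hC hmin
  have hmin' : ∀ D, G.IsVertexCover D → (C : Set V).ncard ≤ D.ncard := fun D hD => by
    rw [Set.ncard_coe_finset, Set.ncard_eq_toFinset_card']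
    exact hmin _ (by simpa using hD)
  obtain ⟨S, hCS, hS⟩ := SimpleGraph.exists_isMatching_of_forall_ncard_le
    (SimpleGraph.between_isBipartiteWith disjoint_compl_right)
    fun s hs => ncard_le_ncard_neighborSet_between hL hC hmin' hs
  have hM : IsMatching S.spanningCoe := fun u v w hv hw => (hS (S.edge_vert hv)).unique hv hw
  refine ⟨C, hC, le_antisymm ?_ (matchingNumber_le_card_of_isVertexCover hC)⟩
  refine (card_le_ncard_edgeSet fun c hc => ?_).trans
    (hM.ncard_edgeSet_le_matchingNumber (S.spanningCoe_le.trans SimpleGraph.between_le))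
  obtain ⟨v, hv, -⟩ := hS (hCS hc)
  have := (SimpleGraph.between_adj.1 hv.adj_sub).2
  exact ⟨v, by simp_all, hv⟩

end MatchingNumber

end Matching

section Profiles

variable {β βm : ℕ} {e : EdgeProfile β}

/-- The positions `N(A)` and `L \ A`: together they form the vertex cover `N(A) ∪ (L \ A)` of `H`,
of the same size as `M`. -/
def Pos.InCover (p : Pos) : Prop := p = Pos.NA ∨ p = Pos.LdiffA

instance (p : Pos) : Decidable p.InCover := inferInstanceAs (Decidable (_ ∨ _))

theorem Pos.InL.not_inR {p : Pos} (h : p.InL) : ¬ p.InR := by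
  rintro (rfl | rfl) <;> simp [Pos.InL] at h

theorem Pos.InL.inCover_iff {p : Pos} (h : p.InL) : p.InCover ↔ p = Pos.LdiffA := by
  rcases h with rfl | rfl <;> simp [Pos.InCover]

theorem Pos.InR.inCover_iff {p : Pos} (h : p.InR) : p.InCover ↔ p = Pos.NA := by
  rcases h with rfl | rfl <;> simp [Pos.InCover]

theorem EdgeProfile.Valid.left_inL (h : e.Valid βm) : e.left.1.pos.InL := h.1.1

theorem EdgeProfile.Valid.right_inR (h : e.Valid βm) : e.right.1.pos.InR := h.1.2

theorem EdgeProfile.Valid.inMstar_of_touches (h : e.Valid βm) (he : e.inMstar = true) {v : VP β}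
    (hv : e.Touches v) : v.1.inMstar = true := by
  obtain ⟨hl, hr⟩ := h.2.2.2.1 he
  rcases hv with rfl | rfl
  exacts [hl, hr]

theorem EdgeProfile.Valid.inH_of_inM (h : e.Valid βm) (he : e.inM = true) : e.inH = true :=
  h.2.2.2.2.1 he

theorem EdgeProfile.Valid.inH_or_inMstar (h : e.Valid βm) : e.inH = true ∨ e.inMstar = true :=
  h.2.2.2.2.2.1

theorem EdgeProfile.Valid.deg_add_deg_le (h : e.Valid βm) (he : e.inH = true) :
    (e.left.1.deg : ℕ) + e.right.1.deg ≤ β :=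
  h.2.2.2.2.2.2.1 he

theorem EdgeProfile.Valid.le_deg_add_deg (h : e.Valid βm) (he : e.inH = false) :
    βm ≤ (e.left.1.deg : ℕ) + e.right.1.deg :=
  h.2.2.2.2.2.2.2.1 he

theorem EdgeProfile.Valid.inCover_of_inH (h : e.Valid βm) (he : e.inH = true) :
    e.left.1.pos.InCover ∨ e.right.1.pos.InCover := by
  have hnot := h.2.2.2.2.2.2.2.2.1 he
  rw [h.left_inL.inCover_iff, h.right_inR.inCover_iff]
  rcases h.left_inL with hl | hl
  · exact Or.inr (h.right_inR.resolve_right fun hr => hnot ⟨hl, hr⟩)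
  · exact Or.inl hl

theorem EdgeProfile.Valid.card_filter_inCover_touches (h : e.Valid βm) (he : e.inM = true) :
    #{v : VP β | v.1.pos.InCover ∧ e.Touches v} = 1 := by
  have hxor := h.2.2.2.2.2.2.2.2.2 he
  rw [← h.left_inL.inCover_iff, ← h.right_inR.inCover_iff] at hxor
  rw [card_eq_one]
  rcases hxor with ⟨hr, hl⟩ | ⟨hl, hr⟩
  · refine ⟨e.right, ?_⟩
    ext v
    grind [EdgeProfile.Touches]
  · refine ⟨e.left, ?_⟩
    ext v
    grind [EdgeProfile.Touches]

theorem EdgeProfile.Valid.exists_touches_deg_pos (hβm : 1 ≤ βm) (h : e.Valid βm) :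
    ∃ v, e.Touches v ∧ 0 < (v.1.deg : ℕ) := by
  by_contra! hdeg
  have hl := hdeg e.left (Or.inl rfl)
  have hr := hdeg e.right (Or.inr rfl)
  cases hH : e.inH with
  | true => exact (h.2.1 hH).1 (Nat.le_zero.1 hl)
  | false =>
    have := h.le_deg_add_deg hH
    omega

end Profiles

section ScaledFeasible

variable {β βm : ℕ}

/-- The constraints of the linear program over an arbitrary `K`, with the total value of `M`
normalised to `N` instead of `1`. The optimum is transported between `K = ℝ`, `ℚ` and `ℕ`; for
`K = ℕ` the values count vertices and edges of a graph. -/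
structure ScaledFeasible {K : Type*} [AddCommMonoid K] [LE K] (β βm : ℕ) (N : K) (x : VP β → K)
    (y : EP β βm → K) : Prop where
  sum_H : ∀ v : VP β,
    ∑ e : EP β βm with e.1.inH = true ∧ e.1.Touches v, y e = (v.1.deg : ℕ) • x v
  sum_M : ∀ v : VP β, v.1.inM = true →
    ∑ e : EP β βm with e.1.inM = true ∧ e.1.Touches v, y e = x v
  sum_Mstar : ∀ v : VP β, v.1.inMstar = true →
    ∑ e : EP β βm with e.1.inMstar = true ∧ e.1.Touches v, y e = x v
  sum_M_eq : ∑ e : EP β βm with e.1.inM = true, y e = N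
  edge_nonneg : ∀ e, 0 ≤ y e
  vertex_nonneg : ∀ v, 0 ≤ x v

theorem lpFeasible_iff {x : VP β → ℝ} {y : EP β βm → ℝ} :
    LPFeasible β βm x y ↔ ScaledFeasible β βm 1 x y := by
  constructor
  · rintro ⟨h1, h2, h3, h4, h5, h6⟩
    exact ⟨fun v => by rw [h1, nsmul_eq_mul], h2, h3, h4, h5, h6⟩
  · rintro ⟨h1, h2, h3, h4, h5, h6⟩
    exact ⟨fun v => by rw [h1, nsmul_eq_mul], h2, h3, h4, h5, h6⟩

variable {K K' : Type*} [AddCommMonoid K] [LE K] [AddCommMonoid K'] [LE K'] {N : K} {x : VP β → K}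
  {y : EP β βm → K}

theorem ScaledFeasible.map (h : ScaledFeasible β βm N x y) (f : K →+ K') (hx : ∀ v, 0 ≤ f (x v))
    (hy : ∀ e, 0 ≤ f (y e)) :
    ScaledFeasible β βm (f N) (fun v => f (x v)) (fun e => f (y e)) where
  sum_H v := by rw [← map_sum, h.sum_H, map_nsmul]
  sum_M v hv := by rw [← map_sum, h.sum_M v hv]
  sum_Mstar v hv := by rw [← map_sum, h.sum_Mstar v hv]
  sum_M_eq := by rw [← map_sum, h.sum_M_eq]
  edge_nonneg := hy
  vertex_nonneg := hx

theorem ScaledFeasible.of_map (f : K →+ K') (hf : Function.Injective f)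
    (h : ScaledFeasible β βm (f N) (fun v => f (x v)) (fun e => f (y e))) (hx : ∀ v, 0 ≤ x v)
    (hy : ∀ e, 0 ≤ y e) : ScaledFeasible β βm N x y where
  sum_H v := hf (by rw [map_sum, h.sum_H, map_nsmul])
  sum_M v hv := hf (by rw [map_sum, h.sum_M v hv])
  sum_Mstar v hv := hf (by rw [map_sum, h.sum_Mstar v hv])
  sum_M_eq := hf (by rw [map_sum, h.sum_M_eq])
  edge_nonneg := hy
  vertex_nonneg := hx

theorem ScaledFeasible.sum_inCover (h : ScaledFeasible β βm N x y) :
    ∑ v : VP β with v.1.pos.InCover, x v = N := by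
  calc ∑ v : VP β with v.1.pos.InCover, x v
      = ∑ v : VP β with v.1.pos.InCover, ∑ e : EP β βm with e.1.inM = true,
          if e.1.Touches v then y e else 0 := by
        refine sum_congr rfl fun v hv => ?_
        rw [← h.sum_M v (v.2.1 (mem_filter.1 hv).2), ← sum_filter, filter_filter]
    _ = ∑ e : EP β βm with e.1.inM = true,
          #{v : VP β | v.1.pos.InCover ∧ e.1.Touches v} • y e := by
        rw [sum_comm]
        refine sum_congr rfl fun e _ => ?_
        rw [← sum_filter, sum_const, filter_filter]
    _ = ∑ e : EP β βm with e.1.inM = true, y e :=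
        sum_congr rfl fun e he => by
          rw [e.2.card_filter_inCover_touches (mem_filter.1 he).2, one_nsmul]
    _ = N := h.sum_M_eq

end ScaledFeasible

section Compactness

open Filter Topology

variable {β βm : ℕ} {N : ℝ} {x : VP β → ℝ} {y : EP β βm → ℝ}

theorem ScaledFeasible.sum_H_le (h : ScaledFeasible β βm N x y) :
    ∑ e : EP β βm with e.1.inH = true, y e ≤ β * N := by
  calc ∑ e : EP β βm with e.1.inH = true, y e
      ≤ ∑ e : EP β βm with e.1.inH = true, ∑ v : VP β with v.1.pos.InCover,
          if e.1.Touches v then y e else 0 := by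
        refine sum_le_sum fun e he => ?_
        obtain ⟨v, hv, htouch⟩ : ∃ v : VP β, v.1.pos.InCover ∧ e.1.Touches v :=
          (e.2.inCover_of_inH (mem_filter.1 he).2).elim (⟨_, ·, Or.inl rfl⟩) (⟨_, ·, Or.inr rfl⟩)
        have hnonneg (w : VP β) : 0 ≤ if e.1.Touches w then y e else 0 := by
          split_ifs
          exacts [h.edge_nonneg e, le_rfl]
        calc y e = if e.1.Touches v then y e else 0 := (if_pos htouch).symm
          _ ≤ _ := single_le_sum (f := fun w => if e.1.Touches w then y e else 0)
              (fun w _ => hnonneg w) (by simpa using hv)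
    _ = ∑ v : VP β with v.1.pos.InCover, (v.1.deg : ℕ) • x v := by
        rw [sum_comm]
        refine sum_congr rfl fun v _ => ?_
        rw [← sum_filter, filter_filter, h.sum_H]
    _ ≤ ∑ v : VP β with v.1.pos.InCover, β • x v :=
        sum_le_sum fun v _ => nsmul_le_nsmul_left (h.vertex_nonneg v) v.1.deg.2.le
    _ = β * N := by rw [sum_nsmul, h.sum_inCover, nsmul_eq_mul]

theorem ScaledFeasible.vertex_le (h : ScaledFeasible β βm N x y) {v : VP β}
    (hv : 0 < (v.1.deg : ℕ)) : x v ≤ β * N := by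
  calc x v ≤ (v.1.deg : ℕ) • x v := le_self_nsmul (h.vertex_nonneg v) hv.ne'
    _ = ∑ e : EP β βm with e.1.inH = true ∧ e.1.Touches v, y e := (h.sum_H v).symm
    _ ≤ ∑ e : EP β βm with e.1.inH = true, y e :=
        sum_le_sum_of_subset_of_nonneg (monotone_filter_right _ fun _ _ => And.left)
          fun e _ _ => h.edge_nonneg e
    _ ≤ β * N := h.sum_H_le

theorem ScaledFeasible.edge_le (hβm : 1 ≤ βm) (h : ScaledFeasible β βm N x y)
    (e : EP β βm) : y e ≤ β * N := by
  rcases e.2.inH_or_inMstar with he | he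
  · exact (single_le_sum (fun e _ => h.edge_nonneg e) (mem_filter.2 ⟨mem_univ e, he⟩)).trans
      h.sum_H_le
  · obtain ⟨v, hv, hdeg⟩ := e.2.exists_touches_deg_pos hβm
    calc y e ≤ ∑ e : EP β βm with e.1.inMstar = true ∧ e.1.Touches v, y e :=
          single_le_sum (fun e _ => h.edge_nonneg e) (mem_filter.2 ⟨mem_univ e, he, hv⟩)
      _ = x v := h.sum_Mstar v (e.2.inMstar_of_touches he hv)
      _ ≤ β * N := h.vertex_le hdeg

/-- The values of the vertex profiles forced by the values `y` of the edge profiles. On a profile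
of degree `0` not matched in `M*` the division by zero gives `0`; any value is feasible there. -/
noncomputable def vertexValues (y : EP β βm → ℝ) (v : VP β) : ℝ :=
  if v.1.inMstar = true then ∑ e : EP β βm with e.1.inMstar = true ∧ e.1.Touches v, y e
  else (∑ e : EP β βm with e.1.inH = true ∧ e.1.Touches v, y e) / ((v.1.deg : ℕ) : ℝ)

theorem continuous_vertexValues (v : VP β) :
    Continuous fun y : EP β βm → ℝ => vertexValues y v := by
  unfold vertexValues
  split_ifs <;> fun_prop

theorem ScaledFeasible.vertexValues_eq (h : ScaledFeasible β βm N x y) {v : VP β}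
    (hv : v.1.inMstar = true ∨ (v.1.deg : ℕ) ≠ 0) :
    vertexValues y v = x v := by
  unfold vertexValues
  split_ifs with hMstar
  · exact h.sum_Mstar v hMstar
  · rw [h.sum_H, nsmul_eq_mul,
      mul_div_cancel_left₀ _ (Nat.cast_ne_zero.2 (hv.resolve_left hMstar))]

theorem scaledFeasible_vertexValues (h : ScaledFeasible β βm N x y) :
    ScaledFeasible β βm N (vertexValues y) y where
  sum_H v := by
    by_cases hv : (v.1.deg : ℕ) = 0
    · rw [h.sum_H, hv, zero_nsmul, zero_nsmul]
    · rw [h.sum_H, h.vertexValues_eq (Or.inr hv)]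
  sum_M v hv := by
    have hdeg : (v.1.deg : ℕ) ≠ 0 := fun h0 => by simp [v.2.2 h0] at hv
    rw [h.sum_M v hv, h.vertexValues_eq (Or.inr hdeg)]
  sum_Mstar v hv := by rw [h.sum_Mstar v hv, h.vertexValues_eq (Or.inl hv)]
  sum_M_eq := h.sum_M_eq
  edge_nonneg := h.edge_nonneg
  vertex_nonneg v := by
    unfold vertexValues
    split_ifs
    exacts [sum_nonneg fun e _ => h.edge_nonneg e,
      div_nonneg (sum_nonneg fun e _ => h.edge_nonneg e) (Nat.cast_nonneg _)]

theorem isClosed_setOf_scaledFeasible :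
    IsClosed {y : EP β βm → ℝ | ScaledFeasible β βm N (vertexValues y) y} := by
  refine IsSeqClosed.isClosed fun y y₀ hy hlim => ?_
  have hval (e : EP β βm) : Tendsto (fun n => y n e) atTop (𝓝 (y₀ e)) := tendsto_pi_nhds.1 hlim e
  have hsum (s : Finset (EP β βm)) : Tendsto (fun n => ∑ e ∈ s, y n e) atTop (𝓝 (∑ e ∈ s, y₀ e)) :=
    tendsto_finsetSum s fun e _ => hval e
  have hx (v : VP β) : Tendsto (fun n => vertexValues (y n) v) atTop (𝓝 (vertexValues y₀ v)) :=
    ((continuous_vertexValues v).tendsto y₀).comp hlim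
  exact {
    sum_H v := tendsto_nhds_unique ((hsum _).congr fun n => (hy n).sum_H v) ((hx v).const_smul _)
    sum_M v hv := tendsto_nhds_unique ((hsum _).congr fun n => (hy n).sum_M v hv) (hx v)
    sum_Mstar v hv := tendsto_nhds_unique ((hsum _).congr fun n => (hy n).sum_Mstar v hv) (hx v)
    sum_M_eq := tendsto_nhds_unique (hsum _)
      (tendsto_const_nhds.congr fun n => (hy n).sum_M_eq.symm)
    edge_nonneg e := ge_of_tendsto' (hval e) fun n => (hy n).edge_nonneg e
    vertex_nonneg v := ge_of_tendsto' (hx v) fun n => (hy n).vertex_nonneg v }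

theorem isCompact_setOf_scaledFeasible (hβm : 1 ≤ βm) :
    IsCompact {y : EP β βm → ℝ | ScaledFeasible β βm N (vertexValues y) y} :=
  isCompact_Icc.of_isClosed_subset isClosed_setOf_scaledFeasible
    fun _ h => Set.mem_Icc.2 ⟨h.edge_nonneg, fun e => h.edge_le hβm e⟩

theorem exists_isLPOptimalValue (hβm : 1 ≤ βm)
    (hne : ∃ (x : VP β → ℝ) (y : EP β βm → ℝ), LPFeasible β βm x y) :
    ∃ r, IsLPOptimalValue β βm r := by
  obtain ⟨x₀, y₀, h₀⟩ := hne
  have hcont : Continuous (lpObjective β βm) := by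
    unfold lpObjective
    fun_prop
  obtain ⟨y, hy, hmax⟩ := (isCompact_setOf_scaledFeasible hβm).exists_isMaxOn
    ⟨y₀, scaledFeasible_vertexValues (lpFeasible_iff.1 h₀)⟩ hcont.continuousOn
  refine ⟨lpObjective β βm y, ⟨vertexValues y, y, lpFeasible_iff.2 hy, rfl⟩, ?_⟩
  rintro _ ⟨x', y', h', rfl⟩
  exact hmax (scaledFeasible_vertexValues (lpFeasible_iff.1 h'))

end Compactness

section Integrality

open Filter Topology

variable {β βm : ℕ}

theorem exists_seq_linearMap_tendsto :
    ∃ φ : ℕ → ℝ →ₗ[ℚ] ℚ, ∀ a : ℝ, Tendsto (fun n => (φ n a : ℝ)) atTop (𝓝 a) := by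
  let b := Module.Basis.ofVectorSpace ℚ ℝ
  have hseq (z : ℝ) : ∃ q : ℕ → ℚ, Tendsto (fun n => (q n : ℝ)) atTop (𝓝 z) := by
    obtain ⟨u, hu, hlim⟩ := mem_closure_iff_seq_limit.1 (Rat.denseRange_cast z)
    choose q hq using hu
    exact ⟨q, by simpa only [hq] using hlim⟩
  choose q hq using fun i => hseq (b i)
  refine ⟨fun n => b.constr ℚ fun i => q i n, fun a => ?_⟩
  have hrepr : ∑ i ∈ (b.repr a).support, (b.repr a i : ℝ) * b i = a := by
    simpa [Finsupp.linearCombination_apply, Finsupp.sum, Rat.smul_def] using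
      b.linearCombination_repr a
  have hlim := tendsto_finsetSum (b.repr a).support fun i _ => (hq i).const_mul (b.repr a i : ℝ)
  rw [hrepr] at hlim
  simpa [Module.Basis.constr_apply, Finsupp.sum] using hlim

theorem exists_linearMap_le_two_mul {ι : Type*} [Finite ι] {a : ι → ℝ} (ha : ∀ i, 0 ≤ a i) :
    ∃ φ : ℝ →ₗ[ℚ] ℚ, 0 < φ 1 ∧ φ 1 < 2 ∧ ∀ i, 0 ≤ φ (a i) ∧ (φ (a i) : ℝ) ≤ 2 * a i := by
  obtain ⟨φ, hφ⟩ := exists_seq_linearMap_tendsto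
  have hev (i : ι) : ∀ᶠ n in atTop, 0 ≤ φ n (a i) ∧ (φ n (a i) : ℝ) ≤ 2 * a i := by
    rcases (ha i).eq_or_lt with h0 | hpos
    · simp [← h0]
    · filter_upwards [(hφ (a i)).eventually_const_lt hpos,
        (hφ (a i)).eventually_lt_const (show a i < 2 * a i by linarith)] with n h1 h2
      exact ⟨Rat.cast_nonneg.1 h1.le, h2.le⟩
  obtain ⟨n, hpos, hlt, hn⟩ := (((hφ 1).eventually_const_lt zero_lt_one).and
    (((hφ 1).eventually_lt_const one_lt_two).and (eventually_all.2 hev))).exists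
  exact ⟨φ n, by exact_mod_cast hpos, by exact_mod_cast hlt, hn⟩

theorem ScaledFeasible.lpFeasible_inv_mul {N : ℝ} {x : VP β → ℝ} {y : EP β βm → ℝ}
    (h : ScaledFeasible β βm N x y) (hN : 0 < N) :
    LPFeasible β βm (fun v => N⁻¹ * x v) (fun e => N⁻¹ * y e) := by
  have hscaled := h.map (AddMonoidHom.mulLeft N⁻¹)
    (fun v => mul_nonneg (inv_nonneg.2 hN.le) (h.vertex_nonneg v))
    (fun e => mul_nonneg (inv_nonneg.2 hN.le) (h.edge_nonneg e))
  simp only [AddMonoidHom.coe_mulLeft, inv_mul_cancel₀ hN.ne'] at hscaled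
  exact lpFeasible_iff.2 hscaled

theorem IsLPOptimalValue.nonneg {r : ℝ} (hr : IsLPOptimalValue β βm r) : 0 ≤ r := by
  obtain ⟨x, y, hxy, rfl⟩ := hr.1
  exact sum_nonneg fun e _ => hxy.edge_nonneg e

theorem IsLPOptimalValue.sum_inMstar_le {r : ℝ} (hr : IsLPOptimalValue β βm r) {N : ℝ} (hN : 0 < N)
    {x : VP β → ℝ} {y : EP β βm → ℝ} (h : ScaledFeasible β βm N x y) :
    ∑ e : EP β βm with e.1.inMstar = true, y e ≤ r * N := by
  have hle := hr.2 ⟨_, _, h.lpFeasible_inv_mul hN, rfl⟩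
  rwa [lpObjective, ← mul_sum, inv_mul_le_iff₀ hN, mul_comm] at hle

/- For an optimal real solution `(x, y)` and a `ℚ`-linear `φ : ℝ → ℚ` close to the inclusion on its
entries, `φ (x, y)` and `2 (x, y) - φ (x, y)` are both feasible up to scaling and average to
`(x, y)`, so both are optimal; the first is rational. -/
theorem IsLPOptimalValue.exists_rat {r : ℝ} (hr : IsLPOptimalValue β βm r) :
    ∃ (N : ℚ) (x : VP β → ℚ) (y : EP β βm → ℚ), 0 < N ∧ ScaledFeasible β βm N x y ∧
      ((∑ e : EP β βm with e.1.inMstar = true, y e : ℚ) : ℝ) = r * N := by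
  obtain ⟨x, y, hxy, hobj⟩ := hr.1
  rw [lpFeasible_iff] at hxy
  obtain ⟨φ, hpos, hlt, hφ⟩ := exists_linearMap_le_two_mul (a := Sum.elim x y)
    (Sum.forall.2 ⟨hxy.vertex_nonneg, hxy.edge_nonneg⟩)
  obtain ⟨hx, hy⟩ := Sum.forall.1 hφ
  have hrat := hxy.map φ.toAddMonoidHom (fun v => (hx v).1) fun e => (hy e).1
  let ratCast : ℚ →+ ℝ := (Rat.castHom ℝ).toAddMonoidHom
  have hle := hr.sum_inMstar_le (Rat.cast_pos.2 hpos) <| hrat.map ratCast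
    (fun v => Rat.cast_nonneg.2 (hx v).1) fun e => Rat.cast_nonneg.2 (hy e).1
  have hlt' : 0 < (2 * 1 - φ 1 : ℝ) := sub_pos.2 (by rw [mul_one]; exact_mod_cast hlt)
  have hle' := hr.sum_inMstar_le hlt' <|
    hxy.map (AddMonoidHom.mulLeft 2 - ratCast.comp φ.toAddMonoidHom)
    (fun v => sub_nonneg.2 (hx v).2) fun e => sub_nonneg.2 (hy e).2
  have hsub : ∑ e : EP β βm with e.1.inMstar = true, (2 * y e - φ (y e) : ℝ) =
      2 * r - ∑ e : EP β βm with e.1.inMstar = true, (φ (y e) : ℝ) := by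
    rw [sum_sub_distrib, ← mul_sum, ← hobj, lpObjective]
  have hge : 2 * r - ∑ e : EP β βm with e.1.inMstar = true, (φ (y e) : ℝ) ≤ r * (2 * 1 - φ 1) :=
    hsub ▸ hle'
  refine ⟨_, _, _, hpos, hrat, (Rat.cast_sum ..).trans (le_antisymm hle ?_)⟩
  change r * φ 1 ≤ ∑ e : EP β βm with e.1.inMstar = true, (φ (y e) : ℝ)
  linarith

theorem exists_nat_mul_eq_natCast {ι : Type*} [Finite ι] {q : ι → ℚ} (hq : ∀ i, 0 ≤ q i) :
    ∃ D : ℕ, 0 < D ∧ ∃ n : ι → ℕ, ∀ i, (n i : ℚ) = D * q i := by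
  cases nonempty_fintype ι
  refine ⟨∏ i, (q i).den, prod_pos fun i _ => (q i).den_pos, ?_⟩
  suffices h : ∀ i, ∃ n : ℕ, (n : ℚ) = (∏ i, (q i).den : ℕ) * q i from Classical.axiomOfChoice h
  intro i
  obtain ⟨c, hc⟩ := dvd_prod_of_mem (fun i => (q i).den) (mem_univ i)
  have hnum : (((q i).num.toNat : ℕ) : ℚ) = (q i).num := by
    exact_mod_cast Int.toNat_of_nonneg (Rat.num_nonneg.2 (hq i))
  refine ⟨c * (q i).num.toNat, ?_⟩
  rw [hc, Nat.cast_mul, Nat.cast_mul, hnum, ← Rat.den_mul_eq_num]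
  ring

theorem ScaledFeasible.exists_nat {N : ℚ} {x : VP β → ℚ} {y : EP β βm → ℚ}
    (h : ScaledFeasible β βm N x y) :
    ∃ D : ℕ, 0 < D ∧ ∃ (N' : ℕ) (n : VP β → ℕ) (m : EP β βm → ℕ),
      ScaledFeasible β βm N' n m ∧ (N' : ℚ) = D * N ∧ ∀ e, (m e : ℚ) = D * y e := by
  obtain ⟨D, hD, k, hk⟩ := exists_nat_mul_eq_natCast (q := Sum.elim x y)
    (by rintro (v | e); exacts [h.vertex_nonneg v, h.edge_nonneg e])
  have hn v : (k (.inl v) : ℚ) = D * x v := hk (.inl v)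
  have hm e : (k (.inr e) : ℚ) = D * y e := hk (.inr e)
  have hN : ((∑ e : EP β βm with e.1.inM = true, k (.inr e) : ℕ) : ℚ) = D * N := by
    rw [Nat.cast_sum, sum_congr rfl fun e _ => hm e, ← mul_sum, h.sum_M_eq]
  refine ⟨D, hD, _, fun v => k (.inl v), fun e => k (.inr e), ?_, hN, hm⟩
  refine .of_map (Nat.castAddMonoidHom ℚ) Nat.cast_injective ?_ (fun _ => Nat.zero_le _)
    fun _ => Nat.zero_le _
  simp only [Nat.coe_castAddMonoidHom, hn, hm, hN]
  exact h.map (AddMonoidHom.mulLeft (D : ℚ))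
    (fun v => mul_nonneg D.cast_nonneg (h.vertex_nonneg v))
    fun e => mul_nonneg D.cast_nonneg (h.edge_nonneg e)

theorem IsLPOptimalValue.exists_nat {r : ℝ} (hr : IsLPOptimalValue β βm r) :
    ∃ (N : ℕ) (n : VP β → ℕ) (m : EP β βm → ℕ), 0 < N ∧ ScaledFeasible β βm N n m ∧
      ((∑ e : EP β βm with e.1.inMstar = true, m e : ℕ) : ℝ) = r * N := by
  obtain ⟨N, x, y, hN, hxy, hobj⟩ := hr.exists_rat
  obtain ⟨D, hD, N', n, m, hnm, hN', hm⟩ := hxy.exists_nat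
  refine ⟨N', n, m, ?_, hnm, ?_⟩
  · have : (0 : ℚ) < N' := hN' ▸ mul_pos (Nat.cast_pos.2 hD) hN
    exact_mod_cast this
  · have hsum : ((∑ e : EP β βm with e.1.inMstar = true, m e : ℕ) : ℚ) =
        D * ∑ e : EP β βm with e.1.inMstar = true, y e := by
      rw [Nat.cast_sum, sum_congr rfl fun e _ => hm e, mul_sum]
    calc ((∑ e : EP β βm with e.1.inMstar = true, m e : ℕ) : ℝ)
        = ((D * ∑ e : EP β βm with e.1.inMstar = true, y e : ℚ) : ℝ) := by exact_mod_cast hsum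
      _ = D * (r * N) := by rw [Rat.cast_mul, hobj, Rat.cast_natCast]
      _ = r * ((D * N : ℚ) : ℝ) := by push_cast; ring
      _ = r * N' := by rw [← hN', Rat.cast_natCast]

end Integrality

section Counting

variable {V : Type*} [Fintype V] [DecidableEq V] {G : SimpleGraph V} [DecidableRel G.Adj]
  {L : Finset V}

theorem card_filter_interedges_eq_degree (hG : G.IsBipartiteWith (L : Set V) (L : Set V)ᶜ) (c : V) :
    #{p ∈ G.interedges L Lᶜ | p.1 = c ∨ p.2 = c} = G.degree c := by
  have hside {u v : V} (huv : G.Adj u v) : u ∈ L ↔ v ∉ L := by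
    have := hG.mem_of_adj huv
    simp only [mem_coe, Set.mem_compl_iff] at this
    tauto
  rw [← G.card_neighborFinset_eq_degree]
  by_cases hc : c ∈ L
  · rw [← card_map (s := G.neighborFinset c) ⟨fun w => (c, w), Prod.mk_right_injective c⟩]
    refine congrArg card (ext fun ⟨a, b⟩ => ?_)
    simp only [mem_filter, G.mem_interedges_iff, mem_compl, mem_map, G.mem_neighborFinset,
      Function.Embedding.coeFn_mk, Prod.mk.injEq]
    grind
  · rw [← card_map (s := G.neighborFinset c) ⟨fun w => (w, c), Prod.mk_left_injective c⟩]
    refine congrArg card (ext fun ⟨a, b⟩ => ?_)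
    simp only [mem_filter, G.mem_interedges_iff, mem_compl, mem_map, G.mem_neighborFinset,
      Function.Embedding.coeFn_mk, Prod.mk.injEq]
    grind [G.adj_comm]

theorem card_filter_interedges_eq_sum_degree (hG : G.IsBipartiteWith (L : Set V) (L : Set V)ᶜ)
    {S : Finset V} (hS : ∀ p ∈ G.interedges L Lᶜ, ¬(p.1 ∈ S ∧ p.2 ∈ S)) :
    #{p ∈ G.interedges L Lᶜ | p.1 ∈ S ∨ p.2 ∈ S} = ∑ c ∈ S, G.degree c := by
  have hcard : ∀ p ∈ G.interedges L Lᶜ,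
      #{c ∈ S | p.1 = c ∨ p.2 = c} = if p.1 ∈ S ∨ p.2 ∈ S then 1 else 0 := by
    intro p hp
    have hpS := hS p hp
    split_ifs with h
    · refine card_eq_one.2 ⟨if p.1 ∈ S then p.1 else p.2, ?_⟩
      ext c
      grind
    · rw [card_eq_zero, filter_eq_empty_iff]
      rintro c hc (rfl | rfl)
      exacts [h (Or.inl hc), h (Or.inr hc)]
  calc #{p ∈ G.interedges L Lᶜ | p.1 ∈ S ∨ p.2 ∈ S}
      = ∑ p ∈ G.interedges L Lᶜ, #{c ∈ S | p.1 = c ∨ p.2 = c} := by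
        rw [card_filter, sum_congr rfl hcard]
    _ = ∑ c ∈ S, #{p ∈ G.interedges L Lᶜ | p.1 = c ∨ p.2 = c} :=
        sum_card_bipartiteAbove_eq_sum_card_bipartiteBelow (fun (p : V × V) c => p.1 = c ∨ p.2 = c)
    _ = ∑ c ∈ S, G.degree c := sum_congr rfl fun c _ => card_filter_interedges_eq_degree hG c

theorem card_interedges_compl_eq (hG : G.IsBipartiteWith (L : Set V) (L : Set V)ᶜ) :
    #(G.interedges L Lᶜ) = G.edgeSet.ncard := by
  have hfilter : {p ∈ G.interedges L Lᶜ | p.1 ∈ L ∨ p.2 ∈ L} = G.interedges L Lᶜ :=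
    filter_true_of_mem fun p hp => Or.inl (G.mem_interedges_iff.1 hp).1
  rw [← hfilter, card_filter_interedges_eq_sum_degree hG, ← G.coe_edgeFinset, Set.ncard_coe_finset]
  · exact SimpleGraph.isBipartiteWith_sum_degrees_eq_card_edges (t := Lᶜ) (by simpa using hG)
  · intro p hp h
    exact mem_compl.1 (G.mem_interedges_iff.1 hp).2.1 h.2

theorem sum_card_filter_subtype_eq {α κ : Type*} [Fintype κ] [DecidableEq κ] {Valid P : κ → Prop}
    [DecidablePred Valid] [DecidablePred P] {s : Finset α} {g : α → κ} (hg : ∀ a ∈ s, Valid (g a)) :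
    ∑ k : {k // Valid k} with P k.1, #{a ∈ s | g a = k} = #{a ∈ s | P (g a)} := by
  have hfiber : ∀ a ∈ s,
      #{k : {k // Valid k} | P k.1 ∧ g a = k} = if P (g a) then 1 else 0 := by
    intro a ha
    split_ifs with h
    · refine card_eq_one.2 ⟨⟨g a, hg a ha⟩, ?_⟩
      ext k
      grind
    · rw [card_eq_zero, filter_eq_empty_iff]
      grind
  calc ∑ k : {k // Valid k} with P k.1, #{a ∈ s | g a = k}
      = ∑ a ∈ s, #{k : {k // Valid k} | P k.1 ∧ g a = k} := by
        simp only [← filter_filter]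
        exact sum_card_bipartiteAbove_eq_sum_card_bipartiteBelow fun (k : {k // Valid k}) a =>
          g a = k
    _ = #{a ∈ s | P (g a)} := by rw [card_filter, sum_congr rfl hfiber]

end Counting

section Profiling

variable {V : Type*} [Fintype V] {β βm : ℕ} {G H M Mstar : SimpleGraph V} [DecidableRel H.Adj]
  {L C : Finset V}

/-- The data from which the profiles of the vertices and edges of `H ∪ M*` are read off. The Hall
witness `A` enters through the vertex cover `C = (L \ A) ∪ N(A)` of `H`, of the same size as `M`. -/
structure IsProfiling (β βm : ℕ) (G H M Mstar : SimpleGraph V) [DecidableRel H.Adj]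
    (L C : Finset V) : Prop where
  isBipartiteWith : G.IsBipartiteWith (L : Set V) (L : Set V)ᶜ
  isEDCS : IsEDCS β βm G H
  isVertexCover : H.IsVertexCover (C : Set V)
  isMatching : IsMatching M
  le : M ≤ H
  card_eq : #C = M.edgeSet.ncard
  isMatching_star : IsMatching Mstar
  star_le : Mstar ≤ G

theorem IsEDCS.degree_lt (h : IsEDCS β βm G H) (hβ : 0 < β) (u : V) : H.degree u < β := by
  rcases (H.degree u).eq_zero_or_pos with h0 | hpos
  · rwa [h0]
  · obtain ⟨v, huv⟩ := (H.degree_pos_iff_exists_adj u).1 hpos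
    have hv := (H.degree_pos_iff_exists_adj v).2 ⟨u, huv.symm⟩
    have := h.deg_add_le u v huv
    omega

namespace IsProfiling

theorem isBipartiteWith_of_le (h : IsProfiling β βm G H M Mstar L C) {Q : SimpleGraph V}
    (hQ : Q ≤ H ⊔ Mstar) : Q.IsBipartiteWith (L : Set V) (L : Set V)ᶜ where
  disjoint := h.isBipartiteWith.disjoint
  mem_of_adj _ _ huv := h.isBipartiteWith.mem_of_adj (hQ.trans (sup_le h.isEDCS.le h.star_le) huv)

theorem mem_iff_notMem (h : IsProfiling β βm G H M Mstar L C) {u v : V} (huv : M.Adj u v) :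
    u ∈ C ↔ v ∉ C := by
  have hcover := h.isVertexCover.mono h.le
  have hnot := h.isMatching.not_mem_and_mem_of_card_eq hcover h.card_eq huv
  have hor := hcover huv
  simp only [mem_coe] at hor
  tauto

theorem degree_pos [DecidableRel M.Adj] (h : IsProfiling β βm G H M Mstar L C) {u : V}
    (hu : u ∈ C) : 0 < M.degree u :=
  (M.degree_pos_iff_exists_adj u).2 <|
    h.isMatching.exists_adj_of_card_eq (h.isVertexCover.mono h.le) h.card_eq hu

variable [DecidableEq V] [DecidableRel M.Adj] [DecidableRel Mstar.Adj] [NeZero β]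

/-- The profile of a vertex. -/
def vertexProfile (h : IsProfiling β βm G H M Mstar L C) (u : V) : VP β where
  val :=
    { pos := if u ∈ L then if u ∈ C then .LdiffA else .A else if u ∈ C then .NA else .RdiffNA
      deg := ⟨H.degree u, h.isEDCS.degree_lt (NeZero.pos β) u⟩
      inM := 0 < M.degree u
      inMstar := 0 < Mstar.degree u }
  property := by
    refine ⟨fun hpos => ?_, fun hdeg => ?_⟩
    · have hu : u ∈ C := by
        split_ifs at hpos <;> simp_all
      simpa using h.degree_pos hu
    · have := SimpleGraph.degree_le_of_le (v := u) h.le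
      simp_all

theorem pos_vertexProfile (h : IsProfiling β βm G H M Mstar L C) (u : V) :
    (h.vertexProfile u).1.pos =
      if u ∈ L then if u ∈ C then .LdiffA else .A else if u ∈ C then .NA else .RdiffNA :=
  rfl

theorem vertexProfile_ne (h : IsProfiling β βm G H M Mstar L C) {u v : V} (hu : u ∈ L)
    (hv : v ∉ L) : h.vertexProfile u ≠ h.vertexProfile v := by
  intro heq
  have := congrArg (fun p => p.1.pos) heq
  simp only [pos_vertexProfile, hu, hv, if_true, if_false] at this
  split_ifs at this

/-- The profile of an edge of `H ∪ M*`, given as the pair of its endpoints in `L` and in `R`. -/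
def edgeProfile (h : IsProfiling β βm G H M Mstar L C) (p : V × V) : EdgeProfile β where
  left := h.vertexProfile p.1
  right := h.vertexProfile p.2
  inH := H.Adj p.1 p.2
  inM := M.Adj p.1 p.2
  inMstar := Mstar.Adj p.1 p.2

theorem valid_edgeProfile (h : IsProfiling β βm G H M Mstar L C) {p : V × V}
    (hp : p ∈ (H ⊔ Mstar).interedges L Lᶜ) : (h.edgeProfile p).Valid βm := by
  obtain ⟨u, v⟩ := p
  obtain ⟨hu, hv, huv⟩ := (SimpleGraph.mem_interedges_iff _).1 hp
  have hv := mem_compl.1 hv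
  have hdeg {Q : SimpleGraph V} [DecidableRel Q.Adj] (hQ : Q.Adj u v) :
      0 < Q.degree u ∧ 0 < Q.degree v :=
    ⟨(Q.degree_pos_iff_exists_adj u).2 ⟨v, hQ⟩, (Q.degree_pos_iff_exists_adj v).2 ⟨u, hQ.symm⟩⟩
  simp only [EdgeProfile.Valid, edgeProfile, decide_eq_true_eq, decide_eq_false_iff_not,
    Pos.InL, Pos.InR]
  refine ⟨?_, fun hH => ⟨(hdeg hH).1.ne', (hdeg hH).2.ne'⟩, fun hM => ?_, fun hM => ?_,
    fun hM => h.le hM, huv, h.isEDCS.deg_add_le u v, fun hH => ?_, fun hH => ?_, fun hM => ?_⟩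
  · simp only [pos_vertexProfile, hu, hv]
    grind
  · exact ⟨decide_eq_true (hdeg hM).1, decide_eq_true (hdeg hM).2⟩
  · exact ⟨decide_eq_true (hdeg hM).1, decide_eq_true (hdeg hM).2⟩
  · exact h.isEDCS.le_deg_add u v (h.star_le (huv.resolve_left hH)) hH
  · have := h.isVertexCover hH
    simp only [mem_coe] at this
    simp only [pos_vertexProfile, hu, hv]
    grind
  · have := h.mem_iff_notMem hM
    simp only [pos_vertexProfile, hu, hv, Xor]
    grind

/-- The number of vertices with a given profile. -/
def vertexCount (h : IsProfiling β βm G H M Mstar L C) (v : VP β) : ℕ :=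
  #{u | h.vertexProfile u = v}

/-- The number of edges of `H ∪ M*` with a given profile. -/
def edgeCount (h : IsProfiling β βm G H M Mstar L C) (e : EP β βm) : ℕ :=
  #{p ∈ (H ⊔ Mstar).interedges L Lᶜ | h.edgeProfile p = e}

theorem sum_edgeCount (h : IsProfiling β βm G H M Mstar L C) (P : EdgeProfile β → Prop)
    [DecidablePred P] : ∑ e : EP β βm with P e.1, h.edgeCount e =
      #{p ∈ (H ⊔ Mstar).interedges L Lᶜ | P (h.edgeProfile p)} :=
  sum_card_filter_subtype_eq fun _ hp => h.valid_edgeProfile hp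

theorem filter_interedges (h : IsProfiling β βm G H M Mstar L C) {Q : SimpleGraph V}
    [DecidableRel Q.Adj] (hQ : Q ≤ H ⊔ Mstar) (flag : EdgeProfile β → Bool)
    (hflag : ∀ p, flag (h.edgeProfile p) = decide (Q.Adj p.1 p.2)) :
    {p ∈ (H ⊔ Mstar).interedges L Lᶜ | flag (h.edgeProfile p) = true} = Q.interedges L Lᶜ := by
  ext p
  have := @hQ p.1 p.2
  simp only [mem_filter, SimpleGraph.mem_interedges_iff, hflag, decide_eq_true_eq]
  tauto

theorem sum_edgeCount_touches (h : IsProfiling β βm G H M Mstar L C) {Q : SimpleGraph V}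
    [DecidableRel Q.Adj] (hQ : Q ≤ H ⊔ Mstar) (flag : EdgeProfile β → Bool)
    (hflag : ∀ p, flag (h.edgeProfile p) = decide (Q.Adj p.1 p.2)) (v : VP β) :
    ∑ e : EP β βm with flag e.1 = true ∧ e.1.Touches v, h.edgeCount e =
      ∑ u with h.vertexProfile u = v, Q.degree u := by
  rw [h.sum_edgeCount fun e => flag e = true ∧ e.Touches v, ← filter_filter,
    h.filter_interedges hQ flag hflag,
    ← card_filter_interedges_eq_sum_degree (h.isBipartiteWith_of_le hQ)]
  · simp only [mem_filter, mem_univ, true_and, EdgeProfile.Touches, edgeProfile]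
    exact congrArg card (filter_congr_decidable ..)
  · intro p hp
    obtain ⟨hL, hR, -⟩ := Q.mem_interedges_iff.1 hp
    simp only [mem_filter, mem_univ, true_and]
    exact fun heq => h.vertexProfile_ne hL (mem_compl.1 hR) (heq.1.trans heq.2.symm)

theorem sum_edgeCount_eq_ncard (h : IsProfiling β βm G H M Mstar L C) {Q : SimpleGraph V}
    [DecidableRel Q.Adj] (hQ : Q ≤ H ⊔ Mstar) (flag : EdgeProfile β → Bool)
    (hflag : ∀ p, flag (h.edgeProfile p) = decide (Q.Adj p.1 p.2)) :
    ∑ e : EP β βm with flag e.1 = true, h.edgeCount e = Q.edgeSet.ncard := by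
  rw [h.sum_edgeCount fun e => flag e = true, h.filter_interedges hQ flag hflag,
    card_interedges_compl_eq (h.isBipartiteWith_of_le hQ)]

theorem sum_edgeCount_isMatching (h : IsProfiling β βm G H M Mstar L C) {Q : SimpleGraph V}
    [DecidableRel Q.Adj] (hQ : Q ≤ H ⊔ Mstar) (hmatch : IsMatching Q) (flag : EdgeProfile β → Bool)
    (hflag : ∀ p, flag (h.edgeProfile p) = decide (Q.Adj p.1 p.2)) {v : VP β}
    (hv : ∀ u, h.vertexProfile u = v → 0 < Q.degree u) :
    ∑ e : EP β βm with flag e.1 = true ∧ e.1.Touches v, h.edgeCount e = h.vertexCount v := by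
  rw [h.sum_edgeCount_touches hQ flag hflag, vertexCount, card_eq_sum_ones]
  exact sum_congr rfl fun u hu =>
    (hmatch.degree_le_one u).antisymm (hv u (mem_filter.1 hu).2)

theorem scaledFeasible (h : IsProfiling β βm G H M Mstar L C) :
    ScaledFeasible β βm M.edgeSet.ncard h.vertexCount h.edgeCount where
  sum_H v := by
    have hdeg : ∀ u ∈ ({u | h.vertexProfile u = v} : Finset V), H.degree u = v.1.deg :=
      fun u hu => (mem_filter.1 hu).2 ▸ rfl
    rw [h.sum_edgeCount_touches le_sup_left EdgeProfile.inH fun _ => rfl, sum_congr rfl hdeg,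
      sum_const, smul_eq_mul, smul_eq_mul, mul_comm, vertexCount]
  sum_M v hv := h.sum_edgeCount_isMatching (h.le.trans le_sup_left) h.isMatching
    EdgeProfile.inM (fun _ => rfl) (by rintro u rfl; simpa [vertexProfile] using hv)
  sum_Mstar v hv := h.sum_edgeCount_isMatching le_sup_right h.isMatching_star
    EdgeProfile.inMstar (fun _ => rfl) (by rintro u rfl; simpa [vertexProfile] using hv)
  sum_M_eq := h.sum_edgeCount_eq_ncard (h.le.trans le_sup_left) EdgeProfile.inM fun _ => rfl
  edge_nonneg _ := Nat.zero_le _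
  vertex_nonneg _ := Nat.zero_le _

end IsProfiling

theorem exists_isProfiling (hG : G.IsBipartite) (h : IsEDCS β βm G H) :
    ∃ (M Mstar : SimpleGraph V) (L C : Finset V), IsProfiling β βm G H M Mstar L C ∧
      M.edgeSet.ncard = matchingNumber H ∧ Mstar.edgeSet.ncard = matchingNumber G := by
  classical
  obtain ⟨L, hL⟩ := exists_isBipartiteWith_compl hG
  obtain ⟨C, hC, hCcard⟩ := exists_isVertexCover_card_eq_matchingNumber (hG.mono_left h.le)
  obtain ⟨M, hMH, hM, hMcard⟩ := exists_isMatching_ncard_edgeSet_eq H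
  obtain ⟨Mstar, hle, hMstar, hcard⟩ := exists_isMatching_ncard_edgeSet_eq G
  exact ⟨M, Mstar, L.toFinset, C,
    { isBipartiteWith := by simpa using hL
      isEDCS := h
      isVertexCover := hC
      isMatching := hM
      le := hMH
      card_eq := hCcard.trans hMcard.symm
      isMatching_star := hMstar
      star_le := hle }, hMcard, hcard⟩

theorem IsEDCS.exists_scaledFeasible (hβ : 0 < β) (hG : G.IsBipartite) (h : IsEDCS β βm G H) :
    ∃ (x : VP β → ℕ) (y : EP β βm → ℕ), ScaledFeasible β βm (matchingNumber H) x y ∧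
      ∑ e : EP β βm with e.1.inMstar = true, y e = matchingNumber G := by
  classical
  have : NeZero β := ⟨hβ.ne'⟩
  obtain ⟨M, Mstar, L, C, hprof, hM, hMstar⟩ := exists_isProfiling hG h
  refine ⟨hprof.vertexCount, hprof.edgeCount, hM ▸ hprof.scaledFeasible, hMstar ▸ ?_⟩
  exact hprof.sum_edgeCount_eq_ncard le_sup_right EdgeProfile.inMstar fun _ => rfl

theorem IsEDCS.eq_bot (hβm : 1 ≤ βm) (h : IsEDCS β βm G H) (h0 : matchingNumber H = 0) :
    G = ⊥ := by
  have hH (u v : V) : ¬ H.Adj u v := fun huv => (matchingNumber_pos_of_adj huv).ne' h0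
  have hdeg (u : V) : H.degree u = 0 :=
    Nat.eq_zero_of_not_pos fun hpos =>
      ((H.degree_pos_iff_exists_adj u).1 hpos).elim fun v huv => hH u v huv
  rw [SimpleGraph.eq_bot_iff_forall_not_adj]
  intro u v huv
  have := h.le_deg_add u v huv (hH u v)
  rw [hdeg, hdeg] at this
  omega

theorem IsEDCS.matchingNumber_le {r : ℝ} (hβm : 1 ≤ βm) (hβ : 0 < β)
    (hr : IsLPOptimalValue β βm r) (hG : G.IsBipartite) (h : IsEDCS β βm G H) :
    (matchingNumber G : ℝ) ≤ r * matchingNumber H := by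
  rcases (matchingNumber H).eq_zero_or_pos with h0 | hpos
  · have hcover : G.IsVertexCover ((∅ : Finset V) : Set V) := by simp [h.eq_bot hβm h0]
    have hG0 : matchingNumber G = 0 :=
      Nat.le_zero.1 (matchingNumber_le_card_of_isVertexCover hcover)
    simp [hG0, h0]
  · obtain ⟨x, y, hxy, hobj⟩ := h.exists_scaledFeasible hβ hG
    have := hr.sum_inMstar_le (Nat.cast_pos.2 hpos) <|
      hxy.map (Nat.castAddMonoidHom ℝ) (fun _ => Nat.cast_nonneg _) fun _ => Nat.cast_nonneg _
    rw [← hobj]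
    push_cast
    exact this

theorem isEDCS_top_fin_two (hβ : 2 ≤ β) :
    IsEDCS β βm (⊤ : SimpleGraph (Fin 2)) ⊤ where
  le := le_rfl
  deg_add_le u v _ := by simpa using hβ
  le_deg_add u v huv h := absurd huv h

theorem exists_lpFeasible (hβ : 2 ≤ β) :
    ∃ (x : VP β → ℝ) (y : EP β βm → ℝ), LPFeasible β βm x y := by
  have hbip : (⊤ : SimpleGraph (Fin 2)).IsBipartite := ⟨SimpleGraph.Coloring.mk id fun h => h.ne⟩
  obtain ⟨x, y, hxy, -⟩ := (isEDCS_top_fin_two (βm := βm) hβ).exists_scaledFeasible (by omega) hbip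
  have hpos : 0 < matchingNumber (⊤ : SimpleGraph (Fin 2)) :=
    matchingNumber_pos_of_adj (u := 0) (v := 1) (by simp)
  have hreal := hxy.map (Nat.castAddMonoidHom ℝ) (fun _ => Nat.cast_nonneg _)
    fun _ => Nat.cast_nonneg _
  exact ⟨_, _, hreal.lpFeasible_inv_mul (Nat.cast_pos.2 hpos)⟩

end Profiling

section Balanced

variable {E : Type*}

theorem exists_image_eq_Ico (s : Finset E) (k : ℕ) :
    ∃ g : E → ℕ, s.image g = Ico k (k + #s) := by
  classical
  refine ⟨fun e => if h : e ∈ s then k + s.equivFin ⟨e, h⟩ else 0, ?_⟩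
  ext i
  simp only [mem_image, mem_Ico]
  constructor
  · rintro ⟨e, he, rfl⟩
    simp [he]
  · rintro ⟨hk, hi⟩
    obtain ⟨e, he⟩ := s.equivFin.surjective ⟨i - k, by omega⟩
    exact ⟨e, e.2, by simp [he, hk]⟩

theorem exists_image_eq_range_image_eq_Ico (H S : Finset E) :
    ∃ (f : E → ℕ) (a : ℕ), H.image f = range #H ∧ S.image f = Ico a (a + #S) := by
  classical
  obtain ⟨f₁, h₁⟩ := exists_image_eq_Ico (H \ S) 0
  obtain ⟨f₂, h₂⟩ := exists_image_eq_Ico (H ∩ S) #(H \ S)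
  obtain ⟨f₃, h₃⟩ := exists_image_eq_Ico (S \ H) #H
  have hH := card_sdiff_add_card_inter H S
  have hS := card_sdiff_add_card_inter S H
  rw [inter_comm] at hS
  let f : E → ℕ := fun e => if e ∈ H then if e ∈ S then f₂ e else f₁ e else f₃ e
  have hf₁ : (H \ S).image f = (H \ S).image f₁ := image_congr fun e he => by simp_all [f]
  have hf₂ : (H ∩ S).image f = (H ∩ S).image f₂ := image_congr fun e he => by simp_all [f]
  have hf₃ : (S \ H).image f = (S \ H).image f₃ := image_congr fun e he => by simp_all [f]
  refine ⟨f, #(H \ S), ?_, ?_⟩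
  · rw [← sdiff_union_inter H S, image_union, hf₁, hf₂, h₁, h₂]
    ext i
    simp only [mem_union, mem_Ico, mem_range, sdiff_union_inter]
    omega
  · rw [← sdiff_union_inter S H, image_union, inter_comm, hf₃, hf₂, h₃, h₂]
    ext i
    simp only [mem_union, mem_Ico, inter_comm H S, sdiff_union_inter]
    rw [inter_comm] at hH hS
    omega

theorem card_filter_range_mul_mod_eq (d : ℕ) {n j : ℕ} (hj : j < n) :
    #{i ∈ range (d * n) | i % n = j} = d := by
  have hmod : ∀ i, i % n = j ↔ i ≡ j [MOD n] := fun i => by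
    rw [Nat.ModEq, Nat.mod_eq_of_lt hj]
  simp only [hmod]
  rw [← Nat.count_eq_card_filter_range, Nat.count_modEq_card _ (by omega)]
  simp [Nat.mul_div_cancel d (show 0 < n by omega)]

theorem card_filter_Ico_mod_eq_le_one {a k n : ℕ} (hk : k ≤ n) (j : ℕ) :
    #{i ∈ Ico a (a + k) | i % n = j} ≤ 1 := by
  refine card_le_one.2 fun i hi i' hi' => ?_
  simp only [mem_filter, mem_Ico] at hi hi'
  exact Nat.ModEq.eq_of_abs_lt (hi.2.trans hi'.2.symm) (by rw [abs_lt]; omega)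

/- Number the edges consecutively, those of `H` first and those of `S` contiguously, and deal them
out to the `n` vertices cyclically. -/
theorem exists_balanced_map [DecidableEq E] {H S : Finset E} {d n : ℕ} (hH : #H = d * n)
    (hS : #S ≤ n) :
    ∃ f : E → ℕ, (∀ e ∈ H ∪ S, f e < n) ∧ (∀ j < n, #{e ∈ H | f e = j} = d) ∧
      ∀ j, #{e ∈ S | f e = j} ≤ 1 := by
  obtain ⟨f, a, hfH, hfS⟩ := exists_image_eq_range_image_eq_Ico H S
  have hinjH : Set.InjOn f H := card_image_iff.1 (by rw [hfH, card_range])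
  have hinjS : Set.InjOn f S := card_image_iff.1 (by rw [hfS, Nat.card_Ico]; omega)
  have hcard {s : Finset E} (hs : Set.InjOn f s) (j : ℕ) :
      #{e ∈ s | f e % n = j} = #{i ∈ s.image f | i % n = j} := by
    rw [filter_image, card_image_of_injOn (hs.mono (filter_subset _ _))]
  refine ⟨fun e => f e % n, fun e he => Nat.mod_lt _ ?_, fun j hj => ?_, fun j => ?_⟩
  · refine Nat.pos_of_ne_zero fun hn => ?_
    simp_all
  · rw [hcard hinjH, hfH, hH, card_filter_range_mul_mod_eq d hj]
  · rw [hcard hinjS, hfS]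
    exact card_filter_Ico_mod_eq_le_one hS j

end Balanced

section Lift

variable {E U : Type*} [DecidableEq E] {l r : E → U} {Q : Finset E}

/-- A simple covering graph of the multigraph on `U` with an edge between `l e` and `r e` for every
`e ∈ Q`: the vertices are the pairs of a vertex of `U` and a set of edges, and moving along the lift
of `e` toggles `e` in that set. -/
def liftGraph (l r : E → U) (Q : Finset E) : SimpleGraph (U × Finset E) where
  Adj x y := ∃ e ∈ Q, s(x.1, y.1) = s(l e, r e) ∧ symmDiff x.2 y.2 = {e}
  symm := ⟨fun _ _ ⟨e, he, h, hs⟩ => ⟨e, he, Sym2.eq_swap.trans h, (symmDiff_comm _ _).trans hs⟩⟩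
  loopless := ⟨fun _ ⟨_, _, _, hs⟩ => by simp at hs⟩

theorem liftGraph_mono {Q' : Finset E} (h : Q ⊆ Q') : liftGraph l r Q ≤ liftGraph l r Q' :=
  fun _ _ ⟨e, he, hxy⟩ => ⟨e, h he, hxy⟩

theorem liftGraph_adj_symmDiff {e : E} (he : e ∈ Q) (s : Finset E) :
    (liftGraph l r Q).Adj (l e, s) (r e, symmDiff s {e}) :=
  ⟨e, he, rfl, symmDiff_symmDiff_cancel_left _ _⟩

theorem degree_liftGraph [DecidableEq U] (x : U × Finset E)
    [Fintype ((liftGraph l r Q).neighborSet x)] :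
    (liftGraph l r Q).degree x = #{e ∈ Q | x.1 ∈ s(l e, r e)} := by
  symm
  refine card_bij (fun e he => (Sym2.Mem.other (mem_filter.1 he).2, symmDiff x.2 {e})) ?_ ?_ ?_
  · intro e he
    rw [SimpleGraph.mem_neighborFinset]
    exact ⟨e, (mem_filter.1 he).1, Sym2.other_spec _, symmDiff_symmDiff_cancel_left _ _⟩
  · intro e he e' he' h
    exact singleton_injective (symmDiff_right_injective x.2 (Prod.ext_iff.1 h).2)
  · intro y hy
    obtain ⟨e, he, hends, hs⟩ := (SimpleGraph.mem_neighborFinset ..).1 hy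
    have hmem : x.1 ∈ s(l e, r e) := hends ▸ Sym2.mem_mk_left _ _
    refine ⟨e, mem_filter.2 ⟨he, hmem⟩, Prod.ext ?_ ?_⟩
    · exact Sym2.congr_right.1 ((Sym2.other_spec hmem).trans hends.symm)
    · rw [← hs, symmDiff_symmDiff_cancel_left]

theorem isMatching_liftGraph [DecidableEq U] (h : ∀ u, #{e ∈ Q | u ∈ s(l e, r e)} ≤ 1) :
    IsMatching (liftGraph l r Q) := by
  rintro x y z ⟨e, he, hy, hys⟩ ⟨e', he', hz, hzs⟩
  obtain rfl : e = e' := card_le_one.1 (h x.1)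
    e (mem_filter.2 ⟨he, hy ▸ Sym2.mem_mk_left _ _⟩)
    e' (mem_filter.2 ⟨he', hz ▸ Sym2.mem_mk_left _ _⟩)
  exact Prod.ext (Sym2.congr_right.1 (hy.trans hz.symm))
    (symmDiff_right_injective x.2 (hys.trans hzs.symm))

variable {T : Set U}

theorem isBipartite_liftGraph (hl : ∀ e, l e ∈ T) (hr : ∀ e, r e ∉ T) :
    (liftGraph l r Q).IsBipartite := by
  refine SimpleGraph.IsBipartiteWith.isBipartite (s := Prod.fst ⁻¹' T) (t := (Prod.fst ⁻¹' T)ᶜ)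
    ⟨disjoint_compl_right, ?_⟩
  rintro ⟨u, s⟩ ⟨v, t⟩ ⟨e, -, hends, -⟩
  obtain ⟨rfl, rfl⟩ | ⟨rfl, rfl⟩ := Sym2.eq_iff.1 hends
  · exact Or.inl ⟨hl e, hr e⟩
  · exact Or.inr ⟨hr e, hl e⟩

theorem card_mul_le_ncard_edgeSet_liftGraph [Fintype E] [Finite U] (hl : ∀ e, l e ∈ T)
    (hr : ∀ e, r e ∉ T) :
    #Q * Fintype.card (Finset E) ≤ (liftGraph l r Q).edgeSet.ncard := by
  rw [← card_univ, ← card_product, ← Set.ncard_coe_finset]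
  refine Set.ncard_le_ncard_of_injOn
    (fun p : E × Finset E => s((l p.1, p.2), (r p.1, symmDiff p.2 {p.1}))) ?_ ?_
  · rintro ⟨e, s⟩ he
    exact liftGraph_adj_symmDiff (mem_product.1 he).1 s
  · rintro ⟨e, s⟩ - ⟨e', s'⟩ - h
    obtain ⟨h1, h2⟩ | ⟨h1, -⟩ := Sym2.eq_iff.1 h
    · obtain rfl : s = s' := (Prod.ext_iff.1 h1).2
      obtain rfl : e = e' := singleton_injective (symmDiff_right_injective s (Prod.ext_iff.1 h2).2)
      rfl
    · have hle : l e = r e' := (Prod.ext_iff.1 h1).1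
      exact absurd (hle ▸ hl e) (hr e')

end Lift

section Realization

variable {β βm : ℕ} {n : VP β → ℕ} {m : EP β βm → ℕ}

theorem card_filter_sigma_fin {κ : Type*} [Fintype κ] (m : κ → ℕ) (P : κ → Prop)
    [DecidablePred P] : #{i : Σ k, Fin (m k) | P i.1} = ∑ k with P k, m k := by
  have hsigma : ({i | P i.1} : Finset (Σ k, Fin (m k))) =
      (univ.filter P).sigma fun _ => univ := by
    ext i
    simp
  simp [hsigma, card_sigma]

theorem eq_sigma_fin_iff {κ : Type*} {n g : κ → ℕ} {k : κ} (hk : g k < n k) {u : Σ k, Fin (n k)} :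
    u = ⟨k, g k, hk⟩ ↔ k = u.1 ∧ g u.1 = u.2 := by
  obtain ⟨k', j⟩ := u
  constructor
  · rintro h
    obtain rfl := congrArg Sigma.fst h
    exact ⟨rfl, by simp_all⟩
  · rintro ⟨rfl, hj⟩
    exact congrArg _ (Fin.ext hj.symm)

/-- A bipartite multigraph with `n v` vertices of every profile `v` and `m e` edges of every profile
`e`, given by the left and right endpoints of the edges: the edges in `H` give each vertex the
degree of its profile, and those in `M*` form a matching. -/
structure IsRealization (l r : (Σ e : EP β βm, Fin (m e)) → Σ v, Fin (n v)) : Prop where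
  fst_left : ∀ i, (l i).1 = i.1.1.left
  fst_right : ∀ i, (r i).1 = i.1.1.right
  card_inH : ∀ u, #{i ∈ {i | i.1.1.inH = true} | u ∈ s(l i, r i)} = u.1.1.deg
  card_inMstar_le : ∀ u, #{i ∈ {i | i.1.1.inMstar = true} | u ∈ s(l i, r i)} ≤ 1

theorem ScaledFeasible.sum_inMstar_touches_le {N : ℕ} (h : ScaledFeasible β βm N n m) (v : VP β) :
    ∑ e : EP β βm with e.1.inMstar = true ∧ e.1.Touches v, m e ≤ n v := by
  by_cases hv : v.1.inMstar = true
  · exact (h.sum_Mstar v hv).le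
  · rw [filter_false_of_mem fun e _ he => hv (e.2.inMstar_of_touches he.1 he.2), sum_empty]
    exact Nat.zero_le _

theorem ScaledFeasible.exists_isRealization {N : ℕ} (h : ScaledFeasible β βm N n m) :
    ∃ l r : (Σ e : EP β βm, Fin (m e)) → Σ v, Fin (n v), IsRealization l r := by
  have hbalanced (v : VP β) := exists_balanced_map
    (H := ({i | i.1.1.inH = true ∧ i.1.1.Touches v} : Finset (Σ e, Fin (m e))))
    (S := {i | i.1.1.inMstar = true ∧ i.1.1.Touches v}) (n := n v)
    ((card_filter_sigma_fin m fun e => e.1.inH = true ∧ e.1.Touches v).trans (h.sum_H v))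
    ((card_filter_sigma_fin m fun e => e.1.inMstar = true ∧ e.1.Touches v).trans_le
      (h.sum_inMstar_touches_le v))
  choose f hlt hH hMstar using hbalanced
  have hlt' {i : Σ e, Fin (m e)} {v : VP β} (hv : i.1.1.Touches v) : f v i < n v :=
    hlt v i (by simpa [hv] using i.1.2.inH_or_inMstar)
  let l : (Σ e, Fin (m e)) → Σ v, Fin (n v) := fun i => ⟨i.1.1.left, f _ i, hlt' (Or.inl rfl)⟩
  let r : (Σ e, Fin (m e)) → Σ v, Fin (n v) := fun i => ⟨i.1.1.right, f _ i, hlt' (Or.inr rfl)⟩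
  have hmem (u : Σ v, Fin (n v)) (i) : u ∈ s(l i, r i) ↔ i.1.1.Touches u.1 ∧ f u.1 i = u.2 := by
    rw [Sym2.mem_iff, eq_sigma_fin_iff (g := (f · i)), eq_sigma_fin_iff (g := (f · i)),
      ← or_and_right]
    rfl
  refine ⟨l, r, fun _ => rfl, fun _ => rfl, fun u => ?_, fun u => ?_⟩
  · rw [← hH u.1 u.2 u.2.2, filter_filter, filter_filter]
    simp only [hmem, and_assoc]
  · refine le_trans (le_of_eq ?_) (hMstar u.1 u.2)
    rw [filter_filter, filter_filter]
    simp only [hmem, and_assoc]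

theorem ScaledFeasible.matchingNumber_liftGraph_pos {N : ℕ} (h : ScaledFeasible β βm N n m)
    (hN : 0 < N) (l r : (Σ e : EP β βm, Fin (m e)) → Σ v, Fin (n v)) :
    0 < matchingNumber (liftGraph l r {i | i.1.1.inH}) := by
  obtain ⟨e, he, hme⟩ := exists_ne_zero_of_sum_ne_zero (h.sum_M_eq.trans_ne hN.ne')
  have hH := e.2.inH_of_inM (mem_filter.1 he).2
  exact matchingNumber_pos_of_adj
    (liftGraph_adj_symmDiff (e := ⟨e, 0, Nat.pos_of_ne_zero hme⟩) (by simpa using hH) ∅)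

namespace IsRealization

variable {l r : (Σ e : EP β βm, Fin (m e)) → Σ v, Fin (n v)}

theorem inL_left (h : IsRealization l r) (i : Σ e, Fin (m e)) : (l i).1.1.pos.InL := by
  rw [h.fst_left]
  exact i.1.2.left_inL

theorem not_inL_right (h : IsRealization l r) (i : Σ e, Fin (m e)) : ¬(r i).1.1.pos.InL := by
  rw [h.fst_right]
  exact fun hL => hL.not_inR i.1.2.right_inR

theorem isEDCS_liftGraph (h : IsRealization l r)
    [DecidableRel (liftGraph l r {i | i.1.1.inH}).Adj] :
    IsEDCS β βm (liftGraph l r univ) (liftGraph l r {i | i.1.1.inH}) := by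
  have hdeg {x y i} (hi : s(x.1, y.1) = s(l i, r i)) :
      (liftGraph l r {i | i.1.1.inH}).degree x + (liftGraph l r {i | i.1.1.inH}).degree y =
        i.1.1.left.1.deg + i.1.1.right.1.deg := by
    rw [degree_liftGraph, degree_liftGraph, h.card_inH, h.card_inH]
    obtain ⟨hx, hy⟩ | ⟨hx, hy⟩ := Sym2.eq_iff.1 hi
    · rw [hx, hy, h.fst_left, h.fst_right]
    · rw [hx, hy, h.fst_left, h.fst_right, add_comm]
  refine ⟨liftGraph_mono (subset_univ _), ?_, ?_⟩
  · rintro x y ⟨i, hi, hends, -⟩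
    rw [hdeg hends]
    exact i.1.2.deg_add_deg_le (mem_filter.1 hi).2
  · rintro x y ⟨i, -, hends, hs⟩ hxy
    rw [hdeg hends]
    refine i.1.2.le_deg_add_deg (Bool.eq_false_iff.2 fun hi => hxy ⟨i, ?_, hends, hs⟩)
    simpa using hi

theorem isVertexCover_liftGraph (h : IsRealization l r) :
    (liftGraph l r {i | i.1.1.inH}).IsVertexCover {x | x.1.1.1.pos.InCover} := by
  rintro x y ⟨i, hi, hends, -⟩
  have hcover := i.1.2.inCover_of_inH (mem_filter.1 hi).2
  rw [← h.fst_left, ← h.fst_right] at hcover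
  obtain ⟨hx, hy⟩ | ⟨hx, hy⟩ := Sym2.eq_iff.1 hends
  · rwa [← hx, ← hy] at hcover
  · rw [← hx, ← hy] at hcover
    exact hcover.symm

theorem matchingNumber_liftGraph_le (h : IsRealization l r) {N : ℕ}
    (hf : ScaledFeasible β βm N n m) :
    matchingNumber (liftGraph l r {i | i.1.1.inH}) ≤
      N * Fintype.card (Finset (Σ e, Fin (m e))) := by
  let C : Finset (Σ v, Fin (n v)) := {u | u.1.1.pos.InCover}
  have hC : #C = N :=
    (card_filter_sigma_fin n fun v => v.1.pos.InCover).trans hf.sum_inCover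
  have := matchingNumber_le_card_of_isVertexCover (C := C ×ˢ univ)
    (by simpa [C, Set.prod_univ] using h.isVertexCover_liftGraph)
  rwa [card_product, hC, card_univ] at this

theorem le_matchingNumber_liftGraph (h : IsRealization l r) :
    (∑ e : EP β βm with e.1.inMstar, m e) * Fintype.card (Finset (Σ e, Fin (m e))) ≤
      matchingNumber (liftGraph l r univ) := by
  rw [← card_filter_sigma_fin m fun e => e.1.inMstar = true]
  calc _ ≤ (liftGraph l r {i | i.1.1.inMstar}).edgeSet.ncard :=
        card_mul_le_ncard_edgeSet_liftGraph (T := {u : Σ v, Fin (n v) | u.1.1.pos.InL})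
          h.inL_left h.not_inL_right
    _ ≤ matchingNumber (liftGraph l r univ) :=
        (isMatching_liftGraph h.card_inMstar_le).ncard_edgeSet_le_matchingNumber
          (liftGraph_mono (subset_univ _))

end IsRealization

theorem ScaledFeasible.exists_isEDCS {N : ℕ} (h : ScaledFeasible β βm N n m) (hN : 0 < N) :
    ∃ (V : Type) (_ : Fintype V) (G H : SimpleGraph V) (_ : DecidableRel H.Adj) (c : ℕ),
      G.IsBipartite ∧ IsEDCS β βm G H ∧ 0 < matchingNumber H ∧ matchingNumber H ≤ N * c ∧
        (∑ e : EP β βm with e.1.inMstar = true, m e) * c ≤ matchingNumber G := by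
  classical
  obtain ⟨l, r, hlr⟩ := h.exists_isRealization
  exact ⟨_, inferInstance, liftGraph l r univ, liftGraph l r {i | i.1.1.inH}, inferInstance, _,
    isBipartite_liftGraph (T := {u | u.1.1.pos.InL}) hlr.inL_left hlr.not_inL_right,
    hlr.isEDCS_liftGraph, h.matchingNumber_liftGraph_pos hN l r,
    hlr.matchingNumber_liftGraph_le h, hlr.le_matchingNumber_liftGraph⟩

end Realization

end EDCS

theorem theorem1_general (β βm : ℕ) (hβm : 1 ≤ βm) (hβ : 2 ≤ β) :
    ∃ r : ℝ, EDCS.IsLPOptimalValue β βm r ∧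
      (∀ (V : Type*) [Fintype V] (G H : SimpleGraph V) [DecidableRel H.Adj],
        G.IsBipartite → EDCS.IsEDCS β βm G H →
          (EDCS.matchingNumber G : ℝ) ≤ r * (EDCS.matchingNumber H : ℝ)) ∧
      (∃ (V : Type) (_ : Fintype V) (G H : SimpleGraph V) (_ : DecidableRel H.Adj),
        G.IsBipartite ∧ EDCS.IsEDCS β βm G H ∧ 0 < EDCS.matchingNumber H ∧
          (EDCS.matchingNumber G : ℝ) = r * (EDCS.matchingNumber H : ℝ)) := by
  obtain ⟨r, hr⟩ := EDCS.exists_isLPOptimalValue hβm (EDCS.exists_lpFeasible hβ)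
  refine ⟨r, hr, fun V _ G H _ hG hH => hH.matchingNumber_le hβm (by omega) hr hG, ?_⟩
  obtain ⟨N, n, m, hN, hfeas, hobj⟩ := hr.exists_nat
  obtain ⟨V, _, G, H, _, c, hG, hH, hpos, hle, hge⟩ := hfeas.exists_isEDCS hN
  refine ⟨V, inferInstance, G, H, inferInstance, hG, hH, hpos,
    le_antisymm (hH.matchingNumber_le hβm (by omega) hr hG) ?_⟩
  calc r * (EDCS.matchingNumber H : ℝ) ≤ r * (N * c : ℕ) :=
        mul_le_mul_of_nonneg_left (Nat.cast_le.2 hle) hr.nonneg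
    _ = ((∑ e : EDCS.EP β βm with e.1.inMstar = true, m e) * c : ℕ) := by
        rw [Nat.cast_mul, Nat.cast_mul, hobj, mul_assoc]
    _ ≤ EDCS.matchingNumber G := Nat.cast_le.2 hge

theorem theorem1 (β βm : ℕ) (hβm : 1 ≤ βm) (hβ : βm < β) :
    ∃ r : ℝ, EDCS.IsLPOptimalValue β βm r ∧
      (∀ (V : Type*) [Fintype V] (G H : SimpleGraph V) [DecidableRel H.Adj],
        G.IsBipartite → EDCS.IsEDCS β βm G H →
          (EDCS.matchingNumber G : ℝ) ≤ r * (EDCS.matchingNumber H : ℝ)) ∧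
      (∃ (V : Type) (_ : Fintype V) (G H : SimpleGraph V) (_ : DecidableRel H.Adj),
        G.IsBipartite ∧ EDCS.IsEDCS β βm G H ∧ 0 < EDCS.matchingNumber H ∧
          (EDCS.matchingNumber G : ℝ) = r * (EDCS.matchingNumber H : ℝ)) := by
  exact theorem1_general β βm hβm (by omega)
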